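/- Let $m\ge 1$ and fix $2m$ distinct points $p_1,\dots,p_{2m}$ on the equator of $S^2=\partial D^3$, labelled in cyclic order. A decorated hemisphere of sign $\varepsilon\in\{+,-\}$ is a finite disjoint union of strings embedded in the closed upper ($\varepsilon=+$) or lower ($\varepsilon=-$) half of $S^2$, each string being either a circle disjoint from the equator or an arc meeting the equator exactly in its two end points, such that the union meets the equator exactly in $\{p_1,\dots,p_{2m}\}$. Let $V_{m,\varepsilon}$ be the complex vector space with basis all these decorated hemispheres. Let $\langle\cdot,\cdot\rangle: V_{m,-\varepsilon}\times V_{m,\varepsilon}\to\mathbb C$ be the bilinear form with $\langle D',D\rangle=\sqrt2^{\,n}$, where $n$ is the number of closed strings of $D'\cup D\subset S^2$. Let $\theta:V_{m,\varepsilon}\to V_{m,-\varepsilon}$ be the antilinear extension of the reflection in the plane of the equator, and let $\tilde V_{m,\varepsilon}$ be the quotient of $V_{m,\varepsilon}$ by the kernel $\{v:\langle w,v\rangle=0\ \text{for all } w\in V_{m,-\varepsilon}\}$. Then for both signs: 1. $\dim_{\mathbb C}\tilde V_{m,\varepsilon}=2^{m-1}$. 2. The form $(v,w)\mapsto\langle\theta(v),w\rangle$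 descends to a (positive definite) inner product on $\tilde V_{m,\varepsilon}$. 3. An orthonormal basis of $\tilde V_{m,\varepsilon}$ is given by the cups with optional charge pairs, normalized by $2^{-m/4}$, as follows. Consider the $m$ cups joining $p_{2i-1}$ to $p_{2i}$, $1\le i\le m$. For $T\subseteq\{1,\dots,m-1\}$ let $D_T$ be a decorated hemisphere without closed strings obtained from the cups by reconnecting cup $k$ with cup $k+1$ for each $k\in T$: $p_{2k}$ is joined to $p_{2k+1}$ for each $k\in T$, and $p_{2i-1}$ is joined to $p_{2j}$ whenever $i\le j$, $\{i,\dots,j-1\}\subseteq T$ and $i-1,j\notin T$. Such $D_T$ exist. A pair of charges between two adjacent cups denotes $\sqrt2$ times the diagram with the two cups reconnected minus the diagram with the two cups left unchanged, so that the cups with charge pairs between cups $k$ and $k+1$ for exactly the $k\in S$ are the vector $$v_S=\sum_{T\subseteq S}\sqrt2^{\,|T|}(-1)^{|S\setminus T|}D_T .$$ For every choice of the $D_T$, the classes of $2^{-m/4}\,v_S$, $S\subseteq\{1,\dots,m-1\}$, form an orthonormal basis of $\tilde V_{m,\varepsilon}$. -/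

import Mathlib

open scoped ComplexConjugate

noncomputable section

namespace Quon

/-- Euclidean three-space, which contains the ball `D³` and its boundary `S²`. -/
abbrev E3 : Type := EuclideanSpace ℝ (Fin 3)

/-- The sphere `S²`, the boundary of the ball `D³`. -/
def sph : Set E3 := Metric.sphere 0 1

/-- The space boundary of the hemisphere `D³_ε`: the closed upper (`ε = 1`) or
lower (`ε = -1`) half of the sphere. -/
def spaceBoundary (ε : ℤˣ) : Set E3 := {x | x ∈ sph ∧ 0 ≤ ((ε : ℤ) : ℝ) * x 2}

/-- The equator, the common boundary circle of the space and the time boundary. -/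
def equator : Set E3 := {x | x ∈ sph ∧ x 2 = 0}

/-- The point of the equator at the angle `t`. -/
def eqPt (t : ℝ) : E3 := !₂[Real.cos t, Real.sin t, 0]

/-- An open string in the space boundary: an embedded arc that meets the equator in
its two end points and nowhere else. -/
def IsOpenString (ε : ℤˣ) (A : Set E3) : Prop :=
  ∃ γ : C(unitInterval, E3), Function.Injective γ ∧ Set.range γ = A ∧
    A ⊆ spaceBoundary ε ∧ ∀ t, γ t ∈ equator ↔ t = 0 ∨ t = 1

/-- A closed string in the space boundary: an embedded circle that avoids the equator. -/
def IsClosedString (ε : ℤˣ) (A : Set E3) : Prop :=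
  ∃ γ : C(Circle, E3), Function.Injective γ ∧ Set.range γ = A ∧
    A ⊆ spaceBoundary ε ∧ ∀ t, γ t ∉ equator

/-- A decorated hemisphere whose boundary points are the points of the equator at the
angles `φ i`: a finite disjoint union of open and closed strings on the space boundary. -/
structure DecHemisphere {m : ℕ} (φ : Fin (2 * m) → ℝ) (ε : ℤˣ) where
  carrier : Set E3
  strings : ∃ 𝒮 : Set (Set E3), 𝒮.Finite ∧ 𝒮.PairwiseDisjoint id ∧ ⋃₀ 𝒮 = carrier ∧
    ∀ A ∈ 𝒮, IsOpenString ε A ∨ IsClosedString ε A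
  boundary : carrier ∩ equator = Set.range fun i => eqPt (φ i)

/-- The partition function of the ball decorated with `C ⊆ S²`: a factor `√2` for every
closed string, that is, for every connected component of `C`. -/
def partitionFunction (C : Set E3) : ℂ := ((√2 : ℝ) : ℂ) ^ Nat.card (ConnectedComponents C)

/-- The reflection of space in the plane of the equator. -/
def mirror (x : E3) : E3 := !₂[x 0, x 1, - x 2]

lemma mirror_mirror (x : E3) : mirror (mirror x) = x := by
  ext i; fin_cases i <;> simp [mirror]

lemma mirror_injective : Function.Injective mirror :=
  Function.LeftInverse.injective mirror_mirror

lemma continuous_mirror : Continuous mirror := by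
  unfold mirror; fun_prop

lemma mirror_mem_sph {x : E3} : mirror x ∈ sph ↔ x ∈ sph := by
  simp [sph, mirror, EuclideanSpace.norm_eq, Fin.sum_univ_three]

lemma mirror_mem_equator {x : E3} : mirror x ∈ equator ↔ x ∈ equator := by
  unfold equator
  rw [Set.mem_ofPred_eq, mirror_mem_sph]
  simp [mirror]

lemma mirror_mem_spaceBoundary {ε : ℤˣ} {x : E3} (h : x ∈ spaceBoundary ε) :
    mirror x ∈ spaceBoundary (-ε) := by
  refine ⟨mirror_mem_sph.2 h.1, ?_⟩
  simpa [mirror] using h.2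

lemma mirror_eqPt (t : ℝ) : mirror (eqPt t) = eqPt t := by
  simp [mirror, eqPt]

lemma IsOpenString.mirror {ε : ℤˣ} {A : Set E3} (h : IsOpenString ε A) :
    IsOpenString (-ε) (Quon.mirror '' A) := by
  obtain ⟨γ, h1, rfl, h3, h4⟩ := h
  refine ⟨⟨Quon.mirror ∘ γ, continuous_mirror.comp γ.continuous⟩,
    mirror_injective.comp h1, Set.range_comp Quon.mirror γ, ?_, fun t => ?_⟩
  · rintro _ ⟨x, hx, rfl⟩
    exact mirror_mem_spaceBoundary (h3 hx)
  · exact mirror_mem_equator.trans (h4 t)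

lemma IsClosedString.mirror {ε : ℤˣ} {A : Set E3} (h : IsClosedString ε A) :
    IsClosedString (-ε) (Quon.mirror '' A) := by
  obtain ⟨γ, h1, rfl, h3, h4⟩ := h
  refine ⟨⟨Quon.mirror ∘ γ, continuous_mirror.comp γ.continuous⟩,
    mirror_injective.comp h1, Set.range_comp Quon.mirror γ, ?_, fun t => ?_⟩
  · rintro _ ⟨x, hx, rfl⟩
    exact mirror_mem_spaceBoundary (h3 hx)
  · exact fun h => h4 t (mirror_mem_equator.1 h)

variable {m : ℕ} {φ : Fin (2 * m) → ℝ} {ε : ℤˣ}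

/-- The mirror image of a decorated hemisphere, on the opposite hemisphere. -/
def DecHemisphere.reflect (D : DecHemisphere φ ε) : DecHemisphere φ (-ε) where
  carrier := mirror '' D.carrier
  strings := by
    obtain ⟨𝒮, hf, hd, hu, hs⟩ := D.strings
    refine ⟨(fun A => mirror '' A) '' 𝒮, hf.image _, ?_, ?_, ?_⟩
    · rintro _ ⟨A, hA, rfl⟩ _ ⟨B, hB, rfl⟩ hne
      have hAB : A ≠ B := fun h => hne (by rw [h])
      exact (Set.disjoint_image_iff mirror_injective).2 (hd hA hB hAB)
    · rw [← hu, Set.sUnion_eq_biUnion, Set.sUnion_eq_biUnion, Set.biUnion_image,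
        Set.image_iUnion₂]
    · rintro _ ⟨A, hA, rfl⟩
      exact (hs A hA).imp IsOpenString.mirror IsClosedString.mirror
  boundary := by
    have h1 : mirror '' equator = equator := by
      ext x
      constructor
      · rintro ⟨y, hy, rfl⟩
        exact mirror_mem_equator.2 hy
      · exact fun hx => ⟨mirror x, mirror_mem_equator.2 hx, mirror_mirror x⟩
    conv_lhs => rw [← h1]
    rw [← Set.image_inter mirror_injective, D.boundary, ← Set.range_comp]
    congr 1
    funext i
    exact mirror_eqPt _

/-- `V_{m,ε}`: the complex vector space spanned by all decorated hemispheres. -/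
abbrev V (φ : Fin (2 * m) → ℝ) (ε : ℤˣ) : Type := DecHemisphere φ ε →₀ ℂ

/-- The bilinear form between `V_{m,-ε}` and `V_{m,ε}`: glue two decorated hemispheres along
the time boundary and take the partition function of the resulting decorated ball. -/
def pairing (φ : Fin (2 * m) → ℝ) (ε : ℤˣ) : V φ (-ε) →ₗ[ℂ] V φ ε →ₗ[ℂ] ℂ :=
  Finsupp.linearCombination ℂ fun D' : DecHemisphere φ (-ε) =>
    Finsupp.linearCombination ℂ fun D : DecHemisphere φ ε =>
      partitionFunction (D'.carrier ∪ D.carrier)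

/-- The antilinear extension `θ : V_{m,ε} → V_{m,-ε}` of the reflection. -/
def reflection (φ : Fin (2 * m) → ℝ) (ε : ℤˣ) : V φ ε →ₛₗ[starRingEnd ℂ] V φ (-ε) where
  toFun v := (v.mapRange (starRingEnd ℂ) (map_zero _)).mapDomain DecHemisphere.reflect
  map_add' v w := by
    rw [Finsupp.mapRange_add (fun a b => map_add _ a b), Finsupp.mapDomain_add]
  map_smul' c v := by
    rw [← Finsupp.mapDomain_smul]
    congr 1
    ext D
    simp

/-- The kernel of the bilinear form in `V_{m,ε}`. -/
def formKernel (φ : Fin (2 * m) → ℝ) (ε : ℤˣ) : Submodule ℂ (V φ ε) :=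
  LinearMap.ker (pairing φ ε).flip

/-- The quotient `Ṽ_{m,ε}` of `V_{m,ε}` modulo the kernel. -/
abbrev VTilde (φ : Fin (2 * m) → ℝ) (ε : ℤˣ) : Type := V φ ε ⧸ formKernel φ ε

/-- Number the boundary points `0, …, 2m - 1`; cup `i` joins the points `2i` and `2i + 1`, and
site `k` lies between the cups `k` and `k + 1`. `IsCupDiagram T D` says that `D` is the diagram
without closed strings obtained from the `m` cups by reconnecting, at every site `k ∈ T`, the right
leg of cup `k` and the left leg of cup `k + 1`: the points `2k + 1` and `2k + 2` get joined,
and in every maximal block `i, …, j` of cups linked by sites in `T`, the outer points `2i` and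
`2j + 1` get joined. For `T = ∅` this is the diagram of the `m` cups. -/
structure IsCupDiagram (T : Finset (Fin (m - 1))) (D : DecHemisphere φ ε) : Prop where
  no_closed_string : ∀ x ∈ D.carrier, ∃ i, JoinedIn D.carrier x (eqPt (φ i))
  inner : ∀ k ∈ T, JoinedIn D.carrier
    (eqPt (φ ⟨2 * k.val + 1, by omega⟩)) (eqPt (φ ⟨2 * k.val + 2, by omega⟩))
  outer : ∀ i j : Fin m, i ≤ j →
    (∀ k : Fin (m - 1), i.val ≤ k.val → k.val < j.val → k ∈ T) →
    (∀ k : Fin (m - 1), k.val + 1 = i.val → k ∉ T) →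
    (∀ k : Fin (m - 1), k.val = j.val → k ∉ T) →
    JoinedIn D.carrier
      (eqPt (φ ⟨2 * i.val, by omega⟩)) (eqPt (φ ⟨2 * j.val + 1, by omega⟩))

/-- The `m` cups with a pair of charges between the cups `k` and `k + 1` for every `k ∈ S`, where
`D T` is the diagram of the cups reconnected at the sites in `T`. A charge pair (a wire between
two strings) stands for `√2` times the reconnected diagram minus the original one; this is the
expansion of all the wires. -/
def chargedCups (D : Finset (Fin (m - 1)) → DecHemisphere φ ε) (S : Finset (Fin (m - 1))) :
    V φ ε :=
  ∑ T ∈ S.powerset, Finsupp.single (D T) (((√2 : ℝ) : ℂ) ^ T.card * (-1) ^ (S \ T).card)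

end Quon

end

/-! A decorated hemisphere enters the form only through its number of closed strings and the
matching `f` of the `2m` boundary points given by its arcs. The matching is noncrossing, because two
paths in a disc with interlaced end points meet (`exists_crossing`). Write `c` for the matching of
the cups and `N` for the number of classes of an equivalence relation on the boundary points. Gluing
hemispheres with matchings `f` and `g` gives `N(f ∨ g)` loops besides the strings that were already
closed (`IsStringData.card_components`).

The core is `euler_formula`: `N(f ∨ g) + N(f ∨ c) + N(g ∨ c) = 2 N(f ∨ g ∨ c) + m`. Geometrically,
shade the regions of both hemispheres that touch the equator along the intervals spanned by the
cups. These are `N(f ∨ c) + N(g ∨ c)` discs, glued along `m` intervals to a planar surface with `N(f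
∨ g ∨ c)` components and `N(f ∨ g)` boundary circles; the formula computes its Euler characteristic
in two ways. The proof is combinatorial: `f` is turned into `g` by rejoining two pairs at a time.

A diagram with matching `f` and `k` closed strings is then represented by a function of spin
configurations, namely `√2 ^ (k - N(f ∨ c))` times the indicator that the spins are constant on the
classes of `f ∨ c`. By the Euler formula the form is `√2 ^ m` times the standard pairing of these
functions (`sum_feature`, `pairing_reflection`). Hence `⟨θ v, v⟩` is a multiple of a sum of squares,
and the kernel of the form is the kernel of `spinMap` (`formKernel_eq_ker`). The functions live on
spins constant on each cup and are invariant under the global flip, so they depend only on the set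
of sites where the spin changes. This bounds the dimension by `2 ^ (m - 1)`
(`exists_injective_quot`).

For the cups reconnected at `T`, the relation `f ∨ c` is `chain T`, with `m - |T|` classes. The
Euler formula gives `√2 ^ (|T| + |T'|) ⟨θ D_T, D_T'⟩ = √2 ^ m * 2 ^ |T ∩ T'|`
(`partitionFunction_cupDiagrams`), and inclusion-exclusion (`sum_charge_signs`) makes the charged
cups orthogonal. There are `2 ^ (m - 1)` of them, so they form a basis. -/

noncomputable section

namespace Quon

/-! ### Crossing of paths in the disc -/

/-- A continuous nowhere vanishing function on the square has a continuous logarithm. -/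
lemma exists_continuous_log {F : unitInterval → unitInterval → ℂ}
    (hF : Continuous fun p : unitInterval × unitInterval => F p.1 p.2) (h0 : ∀ s t, F s t ≠ 0) :
    ∃ g : unitInterval × unitInterval → ℂ, Continuous g ∧ ∀ s t, Complex.exp (g (s, t)) = F s t := by
  have h01 : (0 : ℝ) ≤ 1 := zero_le_one
  -- Clamping the coordinates extends the function to the plane, where it lifts through the covering
  -- `exp` of the punctured plane.
  let r : ℝ × ℝ → unitInterval × unitInterval :=
    fun p => (Set.projIcc 0 1 h01 p.1, Set.projIcc 0 1 h01 p.2)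
  have hr : Continuous r := by
    refine Continuous.prodMk ?_ ?_
    · exact continuous_projIcc.comp continuous_fst
    · exact continuous_projIcc.comp continuous_snd
  have hcont : Continuous fun p : ℝ × ℝ => F (r p).1 (r p).2 := hF.comp hr
  obtain ⟨e₀, he₀⟩ : ∃ e₀, Complex.exp e₀ = F (r 0).1 (r 0).2 :=
    ⟨Complex.log _, Complex.exp_log (h0 _ _)⟩
  obtain ⟨G, ⟨-, hG⟩, -⟩ := Complex.isCoveringMapOn_exp.existsUnique_continuousMap_lifts
    ⟨fun p : ℝ × ℝ => F (r p).1 (r p).2, hcont⟩ (a₀ := (0 : ℝ × ℝ)) he₀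
    (fun p => h0 _ _)
  refine ⟨fun p => G (p.1, p.2), by fun_prop, fun s t => ?_⟩
  have := congrFun hG ((s : ℝ), (t : ℝ))
  simpa [r] using this

/-- A continuous real function whose cosine is positive stays in one window. -/
lemma exists_int_abs_sub_lt {h : unitInterval → ℝ} (hc : Continuous h)
    (hpos : ∀ t, 0 < Real.cos (h t)) :
    ∃ k : ℤ, ∀ t, |h t - 2 * Real.pi * k| < Real.pi / 2 := by
  have hpi := Real.pi_pos
  have key : ∀ (k : ℤ) t, |h t - 2 * Real.pi * k| ≤ Real.pi →
      |h t - 2 * Real.pi * k| < Real.pi / 2 := by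
    intro k t ht
    by_contra! hcon
    have h1 : Real.cos (h t) = Real.cos |h t - 2 * Real.pi * k| := by
      rw [Real.cos_abs, mul_comm (2 * Real.pi), Real.cos_sub_int_mul_two_pi]
    have h2 := Real.cos_nonpos_of_pi_div_two_le_of_le hcon (by linarith)
    linarith [hpos t]
  set k : ℤ := round (h 0 / (2 * Real.pi)) with hk
  have h00 : |h 0 - 2 * Real.pi * k| ≤ Real.pi := by
    have h1 := abs_sub_round (h 0 / (2 * Real.pi))
    have h2 : h 0 - 2 * Real.pi * k = (2 * Real.pi) * (h 0 / (2 * Real.pi) - k) := by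
      field_simp
    rw [h2, abs_mul, abs_of_pos (by positivity)]
    nlinarith
  refine ⟨k, ?_⟩
  have hclopen : IsClopen {t | |h t - 2 * Real.pi * k| < Real.pi / 2} := by
    refine ⟨?_, isOpen_lt (by fun_prop) continuous_const⟩
    have : {t | |h t - 2 * Real.pi * k| < Real.pi / 2} =
        {t | |h t - 2 * Real.pi * k| ≤ Real.pi / 2} := by
      ext t
      simp only [Set.mem_ofPred_eq]
      exact ⟨fun ht => le_of_lt ht, fun ht => key k t (le_trans ht (by linarith))⟩
    rw [this]
    exact isClosed_le (by fun_prop) continuous_const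
  have := hclopen.eq_univ ⟨0, key k 0 h00⟩
  exact fun t => (Set.eq_univ_iff_forall.1 this) t

/-- A complex number in the unit disc other than `e ^ (i a)` lies strictly on the near side of the
tangent at `e ^ (i a)`. -/
lemma cos_im_sub_pos {a : ℝ} {w z : ℂ} (hw : ‖w‖ ≤ 1) (r : ℝ)
    (hz : Complex.exp z = Complex.exp (r * Complex.I) * (Complex.exp (a * Complex.I) - w))
    (hne : Complex.exp (a * Complex.I) ≠ w) :
    0 < Real.cos (z.im - a - r) := by
  set u : ℂ := Complex.exp (-(a * Complex.I)) * w with hu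
  have hun : ‖u‖ ≤ 1 := by
    rw [hu, norm_mul]
    have : ‖Complex.exp (-(a * Complex.I))‖ = 1 := by
      rw [← neg_mul, ← Complex.ofReal_neg, Complex.norm_exp_ofReal_mul_I]
    rw [this, one_mul]; exact hw
  have hu1 : u ≠ 1 := by
    intro h
    apply hne
    have : Complex.exp (a * Complex.I) * u = w := by
      -- Rotating by `-a` moves the boundary point to `1`; a point of the disc other than `1` has
      -- real part below `1`, so `1 - u` has positive real part.
      rw [hu, ← mul_assoc, ← Complex.exp_add]; simp
    rw [← this, h, mul_one]
  have hre : u.re < 1 := by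
    refine lt_of_le_of_ne ((Complex.re_le_norm u).trans hun) fun h => hu1 ?_
    have h2 := Complex.sq_norm u
    rw [Complex.normSq_apply] at h2
    have h3 : u.im = 0 := by
      have : ‖u‖ ^ 2 ≤ 1 := by nlinarith [norm_nonneg u]
      nlinarith [sq_nonneg u.im]
    exact Complex.ext (by simpa using h) (by simpa using h3)
  have hz2 : Complex.exp (z - a * Complex.I - r * Complex.I) = 1 - u := by
    rw [Complex.exp_sub, Complex.exp_sub, hz, hu, Complex.exp_neg]
    field_simp [Complex.exp_ne_zero]
  have h4 := congrArg Complex.re hz2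
  rw [Complex.exp_re] at h4
  simp at h4
  have h5 : 0 < Real.exp z.re * Real.cos (z.im - a - r) := by rw [h4]; linarith
  exact (mul_pos_iff_of_pos_left (Real.exp_pos _)).1 h5

/-- Two windows of width `π` that share a point determine their offset. -/
lemma window_offset {x a b : ℝ} {k l n : ℤ} (hk : |x - a - 2 * Real.pi * k| < Real.pi / 2)
    (hl : |x - b - Real.pi - 2 * Real.pi * l| < Real.pi / 2)
    (h1 : 2 * Real.pi * (n - 1) < a - b) (h2 : a - b < 2 * Real.pi * n) : k - l = 1 - n := by
  have hpi := Real.pi_pos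
  rw [abs_lt] at hk hl
  have h3 : ((k - l + n - 2 : ℤ) : ℝ) < 0 := by
    push_cast
    nlinarith
  have h4 : (0 : ℝ) < ((k - l + n : ℤ) : ℝ) := by
    push_cast
    nlinarith
  have h5 : k - l + n - 2 < 0 := by exact_mod_cast h3
  have h6 : 0 < k - l + n := by exact_mod_cast h4
  omega

/-- Two paths in the closed unit disc with interlaced end points on the circle meet. -/
lemma exists_crossing {a b c d : ℝ} (hab : a < b) (hbc : b < c) (hcd : c < d)
    (hda : d < a + 2 * Real.pi) (f g : C(unitInterval, ℂ)) (hf : ∀ t, ‖f t‖ ≤ 1)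
    (hg : ∀ t, ‖g t‖ ≤ 1) (f0 : f 0 = Complex.exp (a * Complex.I))
    (f1 : f 1 = Complex.exp (c * Complex.I)) (g0 : g 0 = Complex.exp (b * Complex.I))
    (g1 : g 1 = Complex.exp (d * Complex.I)) : ∃ s t, f s = g t := by
  by_contra! hne
  obtain ⟨L, hL, hexp⟩ := exists_continuous_log (F := fun s t => f s - g t) (by fun_prop)
    (fun s t => sub_ne_zero.2 (hne s t))
  have left : ∀ (s : unitInterval) (x : ℝ), f s = Complex.exp (x * Complex.I) →
      ∃ k : ℤ, ∀ t, |(L (s, t)).im - x - 2 * Real.pi * k| < Real.pi / 2 := by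
    intro s x hx
    refine exists_int_abs_sub_lt (h := fun t => (L (s, t)).im - x) (by fun_prop) fun t => ?_
    have := cos_im_sub_pos (a := x) (z := L (s, t)) (hg t) 0 (by simp [hexp, hx])
      (by rw [← hx]; exact hne s t)
    simpa using this
  have right : ∀ (t : unitInterval) (x : ℝ), g t = Complex.exp (x * Complex.I) →
      ∃ k : ℤ, ∀ s, |(L (s, t)).im - x - Real.pi - 2 * Real.pi * k| < Real.pi / 2 := by
    intro t x hx
    refine exists_int_abs_sub_lt (h := fun s => (L (s, t)).im - x - Real.pi) (by fun_prop)
      fun s => ?_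
    exact cos_im_sub_pos (a := x) (z := L (s, t)) (hf s) Real.pi (by simp [hexp, hx])
      (by rw [← hx]; exact (hne s t).symm)
  obtain ⟨k1, h1⟩ := left 0 a f0
  obtain ⟨k2, h2⟩ := left 1 c f1
  obtain ⟨k3, h3⟩ := right 0 b g0
  obtain ⟨k4, h4⟩ := right 1 d g1
  -- Each edge of the square confines the argument to one window, and the corners compare
  -- neighbouring windows. Three corners have offset `1` and one has offset `0`, while going around
  -- the square the offsets must cancel alternately: the boundary has nonzero winding number.
  have e1 := window_offset (n := 0) (h1 0) (h3 0) (by push_cast; linarith) (by push_cast; linarith)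
  have e2 := window_offset (n := 0) (h1 1) (h4 0) (by push_cast; linarith) (by push_cast; linarith)
  have e3 := window_offset (n := 0) (h2 1) (h4 1) (by push_cast; linarith) (by push_cast; linarith)
  have e4 := window_offset (n := 1) (h2 0) (h3 1) (by push_cast; linarith) (by push_cast; linarith)
  omega

/-! ### From the hemisphere to the disc -/

/-- The vertical projection of space to the plane of the equator. -/
def planar (x : E3) : ℂ := ⟨x 0, x 1⟩

lemma continuous_planar : Continuous planar := by
  have : planar = fun x : E3 => ((x 0 : ℝ) : ℂ) + ((x 1 : ℝ) : ℂ) * Complex.I := by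
    funext x
    apply Complex.ext <;> simp [planar]
  rw [this]
  fun_prop

lemma mem_sph_iff {x : E3} : x ∈ sph ↔ x 0 ^ 2 + x 1 ^ 2 + x 2 ^ 2 = 1 := by
  simp [sph, EuclideanSpace.norm_eq, Fin.sum_univ_three]

lemma planar_eqPt (t : ℝ) : planar (eqPt t) = Complex.exp (t * Complex.I) := by
  apply Complex.ext <;> simp [planar, eqPt, Complex.exp_ofReal_mul_I_re,
    Complex.exp_ofReal_mul_I_im]

lemma norm_planar_le {x : E3} (hx : x ∈ sph) : ‖planar x‖ ≤ 1 := by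
  rw [mem_sph_iff] at hx
  have h := Complex.sq_norm (planar x)
  rw [Complex.normSq_apply] at h
  simp only [planar] at h ⊢
  nlinarith [sq_nonneg (x 2), norm_nonneg (⟨x 0, x 1⟩ : ℂ)]

/-- The sphere determines the square of the height, and the hemisphere its sign. -/
lemma planar_injOn (ε : ℤˣ) : Set.InjOn planar (spaceBoundary ε) := by
  intro x hx y hy hxy
  have h0 : x 0 = y 0 := congrArg Complex.re hxy
  have h1 : x 1 = y 1 := congrArg Complex.im hxy
  have hx1 := mem_sph_iff.1 hx.1
  have hy1 := mem_sph_iff.1 hy.1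
  have h2 : x 2 = y 2 := by
    have hsq : x 2 ^ 2 = y 2 ^ 2 := by rw [h0, h1] at hx1; linarith
    have hx2 := hx.2
    have hy2 := hy.2
    rcases Int.units_eq_one_or ε with rfl | rfl
    · simp at hx2 hy2
      nlinarith
    · simp at hx2 hy2
      nlinarith
  ext i
  fin_cases i
  · exact h0
  · exact h1
  · exact h2

lemma eqPt_mem_equator (t : ℝ) : eqPt t ∈ equator := by
  refine ⟨mem_sph_iff.2 ?_, by simp [eqPt]⟩
  simp [eqPt]

lemma IsOpenString.exists_path {ε : ℤˣ} {A : Set E3} (h : IsOpenString ε A) {p q : E3}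
    (hp : p ∈ A) (hq : q ∈ A) (hpe : p ∈ equator) (hqe : q ∈ equator) (hpq : p ≠ q) :
    ∃ γ : C(unitInterval, E3), Set.range γ = A ∧ γ 0 = p ∧ γ 1 = q := by
  obtain ⟨γ, -, rfl, -, h4⟩ := h
  obtain ⟨s, rfl⟩ := hp
  obtain ⟨t, rfl⟩ := hq
  rcases (h4 s).1 hpe with rfl | rfl <;> rcases (h4 t).1 hqe with rfl | rfl
  · exact absurd rfl hpq
  · exact ⟨γ, rfl, rfl, rfl⟩
  · refine ⟨⟨γ ∘ unitInterval.symm, by fun_prop⟩, ?_, by simp, by simp⟩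
    exact unitInterval.symm_bijective.surjective.range_comp γ
  · exact absurd rfl hpq

/-- Open strings with interlaced end points meet. -/
lemma IsOpenString.inter_nonempty {ε : ℤˣ} {A B : Set E3} (hA : IsOpenString ε A)
    (hB : IsOpenString ε B) {a b c d : ℝ} (hab : a < b) (hbc : b < c) (hcd : c < d)
    (hda : d < a + 2 * Real.pi) (ha : eqPt a ∈ A) (hc : eqPt c ∈ A) (hb : eqPt b ∈ B)
    (hd : eqPt d ∈ B) (hac : eqPt a ≠ eqPt c) (hbd : eqPt b ≠ eqPt d) : (A ∩ B).Nonempty := by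
  obtain ⟨f, rfl, f0, f1⟩ := hA.exists_path ha hc (eqPt_mem_equator _) (eqPt_mem_equator _) hac
  obtain ⟨g, rfl, g0, g1⟩ := hB.exists_path hb hd (eqPt_mem_equator _) (eqPt_mem_equator _) hbd
  have hfs : ∀ t, f t ∈ spaceBoundary ε := by
    obtain ⟨γ, -, h2, h3, -⟩ := hA
    exact fun t => h3 ⟨t, rfl⟩
  have hgs : ∀ t, g t ∈ spaceBoundary ε := by
    obtain ⟨γ, -, h2, h3, -⟩ := hB
    exact fun t => h3 ⟨t, rfl⟩
  obtain ⟨s, t, hst⟩ := exists_crossing hab hbc hcd hda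
    ⟨fun t => planar (f t), continuous_planar.comp f.continuous⟩
    ⟨fun t => planar (g t), continuous_planar.comp g.continuous⟩
    (fun t => norm_planar_le (hfs t).1) (fun t => norm_planar_le (hgs t).1)
    (by simp [f0, planar_eqPt]) (by simp [f1, planar_eqPt])
    (by simp [g0, planar_eqPt]) (by simp [g1, planar_eqPt])
  exact ⟨f s, ⟨s, rfl⟩, ⟨t, (planar_injOn ε (hfs s) (hgs t) hst).symm⟩⟩

/-! ### Equivalence relations and their numbers of classes -/

section Setoids

variable {α : Type*}

/-- The equivalence relation generated by `x ~ f x`. -/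
def gen (f : α → α) : Setoid α := Relation.EqvGen.setoid fun x y => f x = y

/-- The equivalence relation generated by `a ~ b`. -/
def link (a b : α) : Setoid α := Relation.EqvGen.setoid fun x y => x = a ∧ y = b

lemma gen_le {f : α → α} {S : Setoid α} : gen f ≤ S ↔ ∀ x, S x (f x) := by
  constructor
  · exact fun h x => h (Relation.EqvGen.rel _ _ rfl)
  · intro h
    exact Setoid.eqvGen_le fun x y hxy => hxy ▸ h x

lemma link_le {a b : α} {S : Setoid α} : link a b ≤ S ↔ S a b := by
  constructor
  · exact fun h => h (Relation.EqvGen.rel _ _ ⟨rfl, rfl⟩)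
  · intro h
    exact Setoid.eqvGen_le fun x y hxy => by rw [hxy.1, hxy.2]; exact h

lemma gen_apply (f : α → α) (x : α) : gen f x (f x) := gen_le.1 le_rfl x

lemma iff_of_le_ker {S : Setoid α} {P : α → Prop} (h : S ≤ Setoid.ker P) {x y : α}
    (hxy : S x y) : P x ↔ P y := iff_of_eq (h hxy)

/-- Since `f` is an involution, one implication suffices. Together with `iff_of_le_ker` this is the
standard way below to show that two points lie in different classes. -/
lemma gen_le_ker {f : α → α} (hf : ∀ x, f (f x) = x) {P : α → Prop}
    (h : ∀ x, P x → P (f x)) : gen f ≤ Setoid.ker P :=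
  gen_le.2 fun x => propext ⟨h x, fun hx => by have := h _ hx; rwa [hf] at this⟩

/-- The number of classes. -/
def numClasses (S : Setoid α) : ℕ := Nat.card (Quotient S)

/-- The relation on the right is already transitive, because a second passage through the new link
undoes the first. -/
lemma sup_link_apply {S : Setoid α} {a b x y : α} (h : (S ⊔ link a b) x y) :
    S x y ∨ (S x a ∧ S y b) ∨ (S x b ∧ S y a) := by
  let T : Setoid α :=
    { r := fun x y => S x y ∨ (S x a ∧ S y b) ∨ (S x b ∧ S y a)
      iseqv := by
        refine ⟨fun x => Or.inl (S.refl x), fun {x y} h => ?_, fun {x y z} h1 h2 => ?_⟩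
        · rcases h with h | h | h
          · exact Or.inl (S.symm h)
          · exact Or.inr (Or.inr h.symm)
          · exact Or.inr (Or.inl h.symm)
        · rcases h1 with h1 | ⟨h1, h1'⟩ | ⟨h1, h1'⟩ <;> rcases h2 with h2 | ⟨h2, h2'⟩ | ⟨h2, h2'⟩
          · exact Or.inl (S.trans h1 h2)
          · exact Or.inr (Or.inl ⟨S.trans h1 h2, h2'⟩)
          · exact Or.inr (Or.inr ⟨S.trans h1 h2, h2'⟩)
          · exact Or.inr (Or.inl ⟨h1, S.trans (S.symm h2) h1'⟩)
          · exact Or.inl (S.trans (S.trans h1 (S.symm h2)) (S.trans h1' (S.symm h2')))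
          · exact Or.inl (S.trans h1 (S.symm h2'))
          · exact Or.inr (Or.inr ⟨h1, S.trans (S.symm h2) h1'⟩)
          · exact Or.inl (S.trans h1 (S.symm h2'))
          · exact Or.inl (S.trans (S.trans h1 (S.symm h2)) (S.trans h1' (S.symm h2'))) }
  have hT : S ⊔ link a b ≤ T :=
    sup_le (fun {x y} h => Or.inl h) (link_le.2 (Or.inr (Or.inl ⟨S.refl a, S.refl b⟩)))
  exact hT h

lemma numClasses_of_not [Finite α] {S : Setoid α} {a b : α} (h : ¬ S a b) :
    numClasses S = numClasses (S ⊔ link a b) + 1 := by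
  have hab : (S ⊔ link a b) a b := link_le.1 le_sup_right
  -- Only the classes of `a` and `b` merge, so the classes other than that of `b` represent each
  -- merged class once.
  let e : {q : Quotient S // q ≠ Quotient.mk S b} → Quotient (S ⊔ link a b) := fun q =>
    Quotient.map' (s₁ := S) id (fun x y hxy => (le_sup_left : S ≤ S ⊔ link a b) hxy) q.1
  have he : Function.Bijective e := by
    constructor
    · rintro ⟨⟨x⟩, hx⟩ ⟨⟨y⟩, hy⟩ hxy
      have h1 : (S ⊔ link a b) x y := Quotient.exact hxy
      have hx' : ¬ S x b := fun h => hx (Quotient.sound h)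
      have hy' : ¬ S y b := fun h => hy (Quotient.sound h)
      rcases sup_link_apply h1 with h2 | h2 | h2
      · exact Subtype.ext (Quotient.sound h2)
      · exact absurd h2.2 hy'
      · exact absurd h2.1 hx'
    · rintro ⟨x⟩
      by_cases hx : S x b
      · refine ⟨⟨Quotient.mk S a, fun h' => h (Quotient.exact h')⟩, Quotient.sound ?_⟩
        exact Setoid.trans' _ hab (Setoid.symm' _ ((le_sup_left : S ≤ S ⊔ link a b) hx))
      · exact ⟨⟨Quotient.mk S x, fun h' => hx (Quotient.exact h')⟩, rfl⟩
  have h1 := Nat.card_congr (Equiv.ofBijective e he)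
  have := Fintype.ofFinite (Quotient S)
  classical
  rw [Nat.card_eq_fintype_card, Fintype.card_subtype_compl, Fintype.card_subtype_eq] at h1
  have h2 : 0 < Fintype.card (Quotient S) := Fintype.card_pos_iff.2 ⟨Quotient.mk S b⟩
  rw [numClasses, numClasses, ← h1, Nat.card_eq_fintype_card]
  omega

lemma numClasses_sup_link [Finite α] {S : Setoid α} {a b : α} (h : S a b) :
    S ⊔ link a b = S := sup_eq_left.2 (link_le.2 h)

/-- Functions constant on the classes are functions on the quotient. -/
lemma card_le_ker [Fintype α] [DecidableEq α] (S : Setoid α) [DecidablePred fun s : α → Bool => S ≤ Setoid.ker s] :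
    (Finset.univ.filter fun s : α → Bool => S ≤ Setoid.ker s).card = 2 ^ numClasses S := by
  rw [← Fintype.card_subtype, ← Nat.card_eq_fintype_card, numClasses]
  have e : {s : α → Bool // S ≤ Setoid.ker s} ≃ (Quotient S → Bool) := Setoid.liftEquiv S
  rw [Nat.card_congr e, Nat.card_fun]
  simp

end Setoids

/-! ### Noncrossing matchings and rejoining of pairs -/

/-- A fixed point free involution. -/
structure IsMatching {α : Type*} (f : α → α) : Prop where
  invol : ∀ x, f (f x) = x
  ne : ∀ x, f x ≠ x

lemma IsMatching.even_card {α : Type*} {f : α → α} (hf : IsMatching f) (A : Finset α)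
    (hA : ∀ x ∈ A, f x ∈ A) : Even A.card := by
  have h : ∑ _x ∈ A, (1 : ZMod 2) = 0 :=
    Finset.sum_involution (fun x _ => f x) (fun _ _ => by decide) (fun x _ _ => hf.ne x)
      (fun x hx => hA x hx) (fun x _ => hf.invol x)
  rw [Finset.sum_const, nsmul_one, ZMod.natCast_eq_zero_iff] at h
  exact even_iff_two_dvd.2 h

lemma IsMatching.gen_iff {α : Type*} {f : α → α} (hf : IsMatching f) {x y : α} :
    gen f x y ↔ y = x ∨ y = f x := by
  constructor
  · intro h
    have := (iff_of_le_ker (P := fun z => z = x ∨ z = f x) (gen_le_ker hf.invol (by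
      rintro z (rfl | rfl)
      · exact Or.inr rfl
      · exact Or.inl (hf.invol _))) h).1 (Or.inl rfl)
    exact this
  · rintro (rfl | rfl)
    · exact Setoid.refl' _ _
    · exact gen_apply f x

lemma IsMatching.numClasses_gen {α : Type*} [Fintype α] {f : α → α} (hf : IsMatching f) :
    2 * numClasses (gen f) = Fintype.card α := by
  classical
  have hq : Fintype (Quotient (gen f)) := Fintype.ofFinite _
  have h := Finset.card_eq_sum_card_fiberwise (s := Finset.univ) (t := Finset.univ)
    (f := fun x : α => Quotient.mk (gen f) x) (fun _ _ => Finset.mem_coe.2 (Finset.mem_univ _))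
  have h2 : ∀ q : Quotient (gen f),
      (Finset.univ.filter fun x : α => Quotient.mk (gen f) x = q).card = 2 := by
    rintro ⟨x⟩
    have : (Finset.univ.filter fun y : α => Quotient.mk (gen f) y = Quotient.mk (gen f) x) =
        {x, f x} := by
      ext y
      simp only [Finset.mem_filter, Finset.mem_univ, true_and, Finset.mem_insert,
        Finset.mem_singleton]
      rw [← hf.gen_iff]
      exact ⟨fun h => Setoid.symm' _ (Quotient.exact h), fun h => Quotient.sound (Setoid.symm' _ h)⟩
    rw [← Finset.card_pair (hf.ne x).symm, ← this]
    rfl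
  rw [Finset.sum_congr rfl (fun q _ => h2 q)] at h
  rw [Finset.sum_const, Finset.card_univ, Finset.card_univ] at h
  rw [numClasses, Nat.card_eq_fintype_card, h]
  simp [mul_comm]

/-- No two pairs of the matching are interlaced. -/
def Noncrossing {n : ℕ} (f : Fin n → Fin n) : Prop := ∀ x y, x < y → y < f x → ¬ f x < f y

section Euler

variable {n : ℕ} {f g : Fin n → Fin n}

/-- The definition excludes partners beyond `f x`; partners before `x` are excluded by applying it
with `f y` as the left point. -/
lemma Noncrossing.mem_Ioo (hf : IsMatching f) (hn : Noncrossing f) {x y : Fin n} (h1 : x < y)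
    (h2 : y < f x) : x < f y ∧ f y < f x := by
  have a1 := hn x y h1 h2
  have a2 := hn (f y) x
  have a3 := hf.invol x
  have a4 := hf.invol y
  rw [a4] at a2
  have h3 : f y ≠ f x := fun h => h1.ne (by rw [← a3, ← a4, h])
  have h4 : f y ≠ x := fun h => h2.ne (by rw [← h, a4])
  refine ⟨?_, lt_of_le_of_ne (not_lt.1 a1) h3⟩
  by_contra! h5
  exact a2 (lt_of_le_of_ne h5 h4) h1 h2

/-- The points strictly between `x` and `f x` are matched among themselves, so their number is even.
-/
lemma Noncrossing.odd_add (hf : IsMatching f) (hn : Noncrossing f) (x : Fin n) :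
    Odd (x.val + (f x).val) := by
  have key : ∀ x : Fin n, x < f x → Odd (x.val + (f x).val) := by
    intro x hx
    have h := hf.even_card (Finset.Ioo x (f x)) (by
      intro y hy
      rw [Finset.mem_Ioo] at hy ⊢
      exact hn.mem_Ioo hf hy.1 hy.2)
    rw [Fin.card_Ioo] at h
    rw [Fin.lt_def] at hx
    rw [Nat.even_iff] at h
    rw [Nat.odd_iff]
    omega
  rcases lt_or_gt_of_ne (hf.ne x) with h | h
  · have := key (f x) (by rwa [hf.invol])
    rwa [hf.invol, add_comm] at this
  · exact key x h

/-- Rejoin the pairs of `a` and `b` so that `a` and `b` become a pair. -/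
def rejoin (f : Fin n → Fin n) (a b x : Fin n) : Fin n :=
  if x = a then b else if x = b then a else if x = f a then f b else if x = f b then f a else f x

lemma rejoin_left (a b : Fin n) : rejoin f a b a = b := if_pos rfl

lemma rejoin_right (a b : Fin n) : rejoin f a b b = a := by
  unfold rejoin
  grind

lemma IsMatching.rejoin (hf : IsMatching f) {a b : Fin n} (hab : a ≠ b) (h : f a ≠ b) :
    IsMatching (Quon.rejoin f a b) := by
  have hi := hf.invol
  have hne := hf.ne
  constructor
  · intro x
    unfold Quon.rejoin
    grind
  · intro x
    unfold Quon.rejoin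
    grind

lemma rejoin_fst (hf : IsMatching f) {a b : Fin n} (h : f a ≠ b) :
    rejoin f a b (f a) = f b := by
  have hi := hf.invol
  have hne := hf.ne
  unfold rejoin
  grind

lemma rejoin_snd (hf : IsMatching f) {a b : Fin n} (h : f a ≠ b) :
    rejoin f a b (f b) = f a := by
  have hi := hf.invol
  have hne := hf.ne
  unfold rejoin
  grind

lemma rejoin_of_ne {a b x : Fin n} (h1 : x ≠ a) (h2 : x ≠ b) (h3 : x ≠ f a) (h4 : x ≠ f b) :
    rejoin f a b x = f x := by
  rw [rejoin, if_neg h1, if_neg h2, if_neg h3, if_neg h4]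

/-- Both sides put `a`, `b`, `f a`, `f b` into one class and agree with `f` elsewhere. This compares
class counts before and after rejoining: each differs from the common value by at most one. -/
lemma gen_sup_link_rejoin (hf : IsMatching f) {a b : Fin n} (h : f a ≠ b) :
    gen f ⊔ link a b = gen (rejoin f a b) ⊔ link a (f a) := by
  have hl : (gen f ⊔ link a b) a b := link_le.1 le_sup_right
  have hr : (gen (rejoin f a b) ⊔ link a (f a)) a (f a) := link_le.1 le_sup_right
  have hl' : ∀ x, (gen f ⊔ link a b) x (f x) := gen_le.1 le_sup_left
  have hr' : ∀ x, (gen (rejoin f a b) ⊔ link a (f a)) x (rejoin f a b x) := gen_le.1 le_sup_left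
  have hr1 := hr' a
  rw [rejoin_left] at hr1
  have hr2 := hr' (f a)
  rw [rejoin_fst hf h] at hr2
  have hr3 := Setoid.trans' _ (Setoid.trans' _ (Setoid.symm' _ hr1) hr) hr2
  apply le_antisymm
  · refine sup_le (gen_le.2 fun x => ?_) (link_le.2 hr1)
    by_cases h1 : x = a
    · rw [h1]; exact hr
    by_cases h2 : x = b
    · rw [h2]; exact hr3
    by_cases h3 : x = f a
    · rw [h3, hf.invol]; exact Setoid.symm' _ hr
    by_cases h4 : x = f b
    · rw [h4, hf.invol]; exact Setoid.symm' _ hr3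
    have := hr' x
    rwa [rejoin_of_ne h1 h2 h3 h4] at this
  · refine sup_le (gen_le.2 fun x => ?_) (link_le.2 (hl' a))
    have h5 : (gen f ⊔ link a b) (f a) (f b) :=
      Setoid.trans' _ (Setoid.symm' _ (hl' a)) (Setoid.trans' _ hl (hl' b))
    by_cases h1 : x = a
    · rw [h1, rejoin_left]; exact hl
    by_cases h2 : x = b
    · rw [h2, rejoin_right]; exact Setoid.symm' _ hl
    by_cases h3 : x = f a
    · rw [h3, rejoin_fst hf h]; exact h5
    by_cases h4 : x = f b
    · rw [h4, rejoin_snd hf h]; exact Setoid.symm' _ h5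
    rw [rejoin_of_ne h1 h2 h3 h4]; exact hl' x

lemma Noncrossing.mem_Ioo_iff (hf : IsMatching f) (hn : Noncrossing f) {x : Fin n} (y : Fin n) :
    (x < y ∧ y < f x) ↔ (x < f y ∧ f y < f x) := by
  refine ⟨fun h => hn.mem_Ioo hf h.1 h.2, fun h => ?_⟩
  have := hn.mem_Ioo hf h.1 h.2
  rwa [hf.invol] at this

/-- Another pair separates neither `a` from `f a` nor `b` from `f b`, and by `hin` it does not
separate `a` from `b`. Hence it does not separate `f a` from `f b` either. -/
lemma Noncrossing.rejoin (hf : IsMatching f) (hn : Noncrossing f) {a b : Fin n} (hab : a < b)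
    (h : f a ≠ b) (hin : ∀ x, a < x → x < b → a < f x ∧ f x < b) :
    Noncrossing (Quon.rejoin f a b) := by
  have hr := hf.rejoin hab.ne h
  have hb : f b ≠ a := fun h' => h (by rw [← h', hf.invol])
  have hfa : ¬ (a < f a ∧ f a < b) := fun h' => by
    have := hin _ h'.1 h'.2
    rw [hf.invol] at this
    exact lt_irrefl _ this.1
  have hfb : ¬ (a < f b ∧ f b < b) := fun h' => by
    have := hin _ h'.1 h'.2
    rw [hf.invol] at this
    exact lt_irrefl _ this.2
  have hord : ∀ x, x ≠ a → x ≠ b → x ≠ f a → x ≠ f b → Quon.rejoin f a b x = f x :=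
    fun x => rejoin_of_ne
  have hina : ∀ x, a < x → x < b → a < Quon.rejoin f a b x ∧ Quon.rejoin f a b x < b := by
    intro x h1 h2
    rw [hord x h1.ne' h2.ne (fun h' => hfa (h' ▸ ⟨h1, h2⟩)) (fun h' => hfb (h' ▸ ⟨h1, h2⟩))]
    exact hin x h1 h2
  intro x y hxy hyx hlt
  have hX : Quon.rejoin f a b (Quon.rejoin f a b x) = x := hr.invol x
  have hY : Quon.rejoin f a b (Quon.rejoin f a b y) = y := hr.invol y
  have hra := rejoin_left (f := f) a b
  have hrb := rejoin_right (f := f) a b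
  have hrfa := rejoin_fst hf h
  have hrfb := rejoin_snd hf h
  have g1 := fun z => hn.mem_Ioo_iff hf (x := x) z
  have g2 := fun z => hn.mem_Ioo_iff hf (x := y) z
  have hi := hf.invol
  have hne := hf.ne
  have hnea := hne a
  have hneb := hne b
  have hinj : f a ≠ f b := fun h' => hab.ne (by rw [← hi a, h', hi])
  by_cases x1 : x = a
  · grind
  by_cases x2 : x = b
  · grind
  by_cases y1 : y = a
  · grind
  by_cases y2 : y = b
  · grind
  by_cases x3 : x = f a
  · grind
  by_cases x4 : x = f b
  · grind
  by_cases y3 : y = f a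
  · grind
  by_cases y4 : y = f b
  · grind
  rw [hord x x1 x2 x3 x4] at hyx hlt
  rw [hord y y1 y2 y3 y4] at hlt
  exact hn x y hxy hyx hlt

/-- The parity argument: classes of `c` and of a matching restricted away from `X`. -/
lemma even_card_inter {f c : Fin n → Fin n} (hf : IsMatching f) (hc : IsMatching c)
    (A X : Finset (Fin n)) (hA : ∀ x ∈ A, c x ∈ A) (hX : ∀ x ∈ A, x ∉ X → f x ∈ A ∧ f x ∉ X) :
    Even (A ∩ X).card := by
  have h1 := hc.even_card A hA
  have h2 := hf.even_card (A \ X) (by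
    intro x hx
    rw [Finset.mem_sdiff] at hx ⊢
    exact hX x hx.1 hx.2)
  rw [← Finset.card_inter_add_card_sdiff A X] at h1
  exact (Nat.even_add.1 h1).2 h2

/-- A pair whose left point is even bounds a set that is closed under the matching and the cups. -/
lemma closed_Icc {f c : Fin n → Fin n} (hf : IsMatching f) (hc : IsMatching c)
    (hcv : ∀ x : Fin n, (c x).val = if x.val % 2 = 0 then x.val + 1 else x.val - 1)
    {u v : Fin n} (hu : u.val % 2 = 0)
    (huf : ∀ x, u ≤ x → x ≤ v → u ≤ f x ∧ f x ≤ v) (hv : v.val % 2 = 1) :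
    gen f ⊔ gen c ≤ Setoid.ker fun x => u ≤ x ∧ x ≤ v := by
  refine sup_le (gen_le_ker hf.invol fun x hx => huf x hx.1 hx.2) (gen_le_ker hc.invol fun x hx => ?_)
  have := hcv x
  obtain ⟨h1, h2⟩ := hx
  rw [Fin.le_def] at h1 h2 ⊢
  rw [Fin.le_def]
  split_ifs at this <;> omega

end Euler

/-! ### The Euler formula -/

section Euler

variable {n : ℕ} {f g c : Fin n → Fin n}

/-- The matching of the points `2i` and `2i + 1`. -/
def IsCups (c : Fin n → Fin n) : Prop :=
  ∀ x : Fin n, (c x).val = if x.val % 2 = 0 then x.val + 1 else x.val - 1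

lemma link_le_gen {α : Type*} {f : α → α} {a b : α} (h : f a = b) : link a b ≤ gen f :=
  link_le.2 (h ▸ gen_apply f a)

/-- A common pair of both matchings is a loop by itself. -/
lemma not_sup_of_gen_eq (hf : IsMatching f) (hg : IsMatching g) {a b : Fin n} (hfa : f a = b)
    (hga : g a = b) {x : Fin n} (hxa : x ≠ a) (hxb : x ≠ b) : ¬ (gen f ⊔ gen g) a x := by
  intro h
  have hfb : f b = a := by rw [← hfa, hf.invol]
  have hgb : g b = a := by rw [← hga, hg.invol]
  have := (iff_of_le_ker (P := fun z => z = a ∨ z = b) (sup_le (gen_le_ker hf.invol (by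
    rintro z (rfl | rfl)
    · exact Or.inr hfa
    · exact Or.inl hfb)) (gen_le_ker hg.invol (by
    rintro z (rfl | rfl)
    · exact Or.inr hga
    · exact Or.inl hgb))) h).1 (Or.inl rfl)
  tauto

/-- Rejoining towards a pair of `g` adds one loop with `g`. -/
lemma numClasses_rejoin (hf : IsMatching f) (hg : IsMatching g) {a b : Fin n} (hab : a ≠ b)
    (h : f a ≠ b) (hga : g a = b) :
    numClasses (gen (rejoin f a b) ⊔ gen g) = numClasses (gen f ⊔ gen g) + 1 := by
  have h1 : ¬ (gen (rejoin f a b) ⊔ gen g) a (f a) :=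
    not_sup_of_gen_eq (hf.rejoin hab h) hg (rejoin_left a b) hga (hf.ne a) h
  rw [numClasses_of_not h1, sup_right_comm, ← gen_sup_link_rejoin hf h, sup_assoc,
    sup_eq_right.2 (link_le_gen hga)]

/-- The case where the region between the two pairs is cut by rejoining. -/
lemma euler_step_even (hf : IsMatching f) (hg : IsMatching g)
    (hgn : Noncrossing g) (hc : IsMatching c) (hcv : IsCups c) {a b : Fin n} (hab : a < b)
    (h : f a ≠ b) (hga : g a = b) (hin : ∀ x, a < x → x < b → f x = g x) (ha : a.val % 2 = 0) :
    numClasses (gen (rejoin f a b) ⊔ gen c) = numClasses (gen f ⊔ gen c) + 1 ∧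
    numClasses (gen (rejoin f a b) ⊔ gen g ⊔ gen c) =
      numClasses (gen f ⊔ gen g ⊔ gen c) + 1 := by
  have hr := hf.rejoin hab.ne h
  have hb : b.val % 2 = 1 := by
    have := hgn.odd_add hg a
    rw [hga, Nat.odd_iff] at this
    omega
  have hgb : g b = a := by rw [← hga, hg.invol]
  have hgin : ∀ x, a < x → x < b → a < g x ∧ g x < b := fun x h1 h2 => by
    have := hgn.mem_Ioo hg h1 (hga ▸ h2)
    rwa [hga] at this
  have hfin : ∀ x, a < x → x < b → a < f x ∧ f x < b := fun x h1 h2 => by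
    rw [hin x h1 h2]; exact hgin x h1 h2
  have hfa : ¬ (a < f a ∧ f a < b) := fun h' => by
    have := hfin _ h'.1 h'.2
    rw [hf.invol] at this
    exact lt_irrefl _ this.1
  have hfb : ¬ (a < f b ∧ f b < b) := fun h' => by
    have := hfin _ h'.1 h'.2
    rw [hf.invol] at this
    exact lt_irrefl _ this.2
  have hrin : ∀ x, a ≤ x → x ≤ b → a ≤ rejoin f a b x ∧ rejoin f a b x ≤ b := by
    intro x h1 h2
    rcases eq_or_lt_of_le h1 with rfl | h1
    · rw [rejoin_left]; exact ⟨hab.le, le_rfl⟩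
    rcases eq_or_lt_of_le h2 with rfl | h2
    · rw [rejoin_right]; exact ⟨le_rfl, hab.le⟩
    rw [rejoin_of_ne h1.ne' h2.ne (fun h' => hfa (by rw [← h']; exact ⟨h1, h2⟩))
      (fun h' => hfb (by rw [← h']; exact ⟨h1, h2⟩))]
    exact ⟨(hfin x h1 h2).1.le, (hfin x h1 h2).2.le⟩
  have hgin' : ∀ x, a ≤ x → x ≤ b → a ≤ g x ∧ g x ≤ b := by
    intro x h1 h2
    rcases eq_or_lt_of_le h1 with rfl | h1
    · rw [hga]; exact ⟨hab.le, le_rfl⟩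
    rcases eq_or_lt_of_le h2 with rfl | h2
    · rw [hgb]; exact ⟨le_rfl, hab.le⟩
    exact ⟨(hgin x h1 h2).1.le, (hgin x h1 h2).2.le⟩
  -- As `a` is even and `b` is odd, the interval from `a` to `b` is a union of cups. After rejoining
  -- it is closed under all three matchings and is therefore cut off from `f a`.
  have k1 := closed_Icc hr hc hcv ha hrin hb
  have k2 := closed_Icc hg hc hcv ha hgin' hb
  have hout : ¬ (a ≤ f a ∧ f a ≤ b) := fun h' =>
    hfa ⟨lt_of_le_of_ne h'.1 (hf.ne a).symm, lt_of_le_of_ne h'.2 h⟩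
  have n1 : ¬ (gen (rejoin f a b) ⊔ gen c) a (f a) := fun h' =>
    hout ((iff_of_le_ker k1 h').1 ⟨le_rfl, hab.le⟩)
  have n2 : ¬ (gen (rejoin f a b) ⊔ gen g ⊔ gen c) a (f a) := fun h' =>
    hout ((iff_of_le_ker (sup_le (sup_le (le_sup_left.trans k1) (le_sup_left.trans k2))
      (le_sup_right.trans k1)) h').1 ⟨le_rfl, hab.le⟩)
  have hconn : (gen f ⊔ gen c) a b := by
    by_contra hcon
    -- Keep only the pairs of `f` strictly inside the interval. If `b` were not reached, the class
    -- of `a` would contain exactly one point with a cut pair, namely `a`, against parity.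
    let f₀ : Fin n → Fin n := fun x => if a < x ∧ x < b then f x else x
    have hf0 : ∀ x, f₀ (f₀ x) = x := by
      intro x
      have := hfin x
      have := hf.invol x
      simp only [f₀]
      grind
    set R := gen f₀ ⊔ gen c with hR
    have hRle : R ≤ gen f ⊔ gen c := by
      refine sup_le (gen_le.2 fun x => ?_) le_sup_right
      simp only [f₀]
      split_ifs
      · exact (le_sup_left : gen f ≤ _) (gen_apply f x)
      · exact Setoid.refl' _ _
    have hRker : R ≤ Setoid.ker fun x => a ≤ x ∧ x ≤ b := by
      refine sup_le (gen_le_ker hf0 fun x hx => ?_) (le_sup_right.trans k1)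
      simp only [f₀]
      split_ifs with h1
      · exact ⟨(hfin x h1.1 h1.2).1.le, (hfin x h1.1 h1.2).2.le⟩
      · exact hx
    classical
    let A : Finset (Fin n) := Finset.univ.filter fun x => R a x
    have hmem : ∀ x, x ∈ A ↔ R a x := fun x => by simp [A]
    have hev := even_card_inter hf hc A {a} (by
      intro x hx
      rw [hmem] at hx ⊢
      exact Setoid.trans' _ hx ((le_sup_right : gen c ≤ R) (gen_apply c x))) (by
      intro x hx hxa
      rw [hmem] at hx
      rw [Finset.mem_singleton] at hxa
      have hx1 := (iff_of_le_ker hRker hx).1 ⟨le_rfl, hab.le⟩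
      have hxb : x ≠ b := fun h' => hcon (h' ▸ hRle hx)
      have h1 := lt_of_le_of_ne hx1.1 (Ne.symm hxa)
      have h2 := lt_of_le_of_ne hx1.2 hxb
      have h3 : R x (f x) := by
        have := (le_sup_left : gen f₀ ≤ R) (gen_apply f₀ x)
        simpa [f₀, h1, h2] using this
      rw [hmem, Finset.mem_singleton]
      exact ⟨Setoid.trans' _ hx h3, (hfin x h1 h2).1.ne'⟩)
    have : A ∩ {a} = {a} := by
      rw [Finset.inter_eq_right, Finset.singleton_subset_iff, hmem]
    rw [this] at hev
    simp at hev
  constructor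
  · rw [numClasses_of_not n1, sup_right_comm, ← gen_sup_link_rejoin hf h, sup_right_comm,
      numClasses_sup_link hconn]
  · rw [numClasses_of_not n2, sup_right_comm, sup_right_comm _ (gen g),
      ← gen_sup_link_rejoin hf h, sup_assoc (gen f), sup_eq_right.2 (link_le_gen hga)]

/-- The case where the regions at the two pairs are merged by rejoining. -/
lemma euler_step_odd (hf : IsMatching f) (hfn : Noncrossing f) (hg : IsMatching g)
    (hgn : Noncrossing g) (hc : IsMatching c) (hcv : IsCups c) {a b : Fin n} (hab : a < b)
    (h : f a ≠ b) (hga : g a = b) (hin : ∀ x, a < x → x < b → f x = g x) (ha : a.val % 2 = 1) :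
    numClasses (gen (rejoin f a b) ⊔ gen c) + 1 = numClasses (gen f ⊔ gen c) ∧
    numClasses (gen (rejoin f a b) ⊔ gen g ⊔ gen c) =
      numClasses (gen f ⊔ gen g ⊔ gen c) := by
  have hr := hf.rejoin hab.ne h
  have hfb0 : f b ≠ a := fun h' => h (by rw [← h', hf.invol])
  have hinj : f a ≠ f b := fun h' => hab.ne (by rw [← hf.invol a, h', hf.invol])
  have hb : b.val % 2 = 0 := by
    have := hgn.odd_add hg a
    rw [hga, Nat.odd_iff] at this
    omega
  have hgin : ∀ x, a < x → x < b → a < g x ∧ g x < b := fun x h1 h2 => by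
    have := hgn.mem_Ioo hg h1 (hga ▸ h2)
    rwa [hga] at this
  have hfin : ∀ x, a < x → x < b → a < f x ∧ f x < b := fun x h1 h2 => by
    rw [hin x h1 h2]; exact hgin x h1 h2
  have hfa : ¬ (a < f a ∧ f a < b) := fun h' => by
    have := hfin _ h'.1 h'.2
    rw [hf.invol] at this
    exact lt_irrefl _ this.1
  have hfb : ¬ (a < f b ∧ f b < b) := fun h' => by
    have := hfin _ h'.1 h'.2
    rw [hf.invol] at this
    exact lt_irrefl _ this.2
  have oa := hfn.odd_add hf a
  have ob := hfn.odd_add hf b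
  rw [Nat.odd_iff] at oa ob
  have hdis : ¬ (gen f ⊔ gen c) a b := by
    intro hcon
    have hclosed : ∀ u, u < f u → ∀ x, u ≤ x → x ≤ f u → u ≤ f x ∧ f x ≤ f u := by
      intro u hu x h1 h2
      rcases eq_or_lt_of_le h1 with rfl | h1
      · exact ⟨hu.le, le_rfl⟩
      rcases eq_or_lt_of_le h2 with rfl | h2
      · rw [hf.invol]; exact ⟨le_rfl, hu.le⟩
      have := hfn.mem_Ioo hf h1 h2
      exact ⟨this.1.le, this.2.le⟩
    -- If `f a < a`, the interval from `f a` to `a` is a closed union of cups without `b`. Otherwise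
    -- `b < f b < f a`, and the interval from `b` to `f b` is one without `a`.
    rcases lt_or_gt_of_ne (hf.ne a) with h1 | h1
    · have hu : f a < f (f a) := by rwa [hf.invol]
      have k := closed_Icc hf hc hcv (u := f a) (v := f (f a)) (by omega) (hclosed (f a) hu)
        (by rw [hf.invol]; omega)
      rw [hf.invol] at k
      exact absurd ((iff_of_le_ker k hcon).1 ⟨h1.le, le_rfl⟩).2 (not_le.2 hab)
    · have h2 : b < f a := lt_of_le_of_ne (not_lt.1 fun h' => hfa ⟨h1, h'⟩) h.symm
      have h3 := hfn.mem_Ioo hf hab h2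
      have h4 : b < f b := lt_of_le_of_ne (not_lt.1 fun h' => hfb ⟨h3.1, h'⟩) (hf.ne b).symm
      have k := closed_Icc hf hc hcv (u := b) (v := f b) hb (hclosed b h4) (by omega)
      exact absurd ((iff_of_le_ker k hcon).2 ⟨le_rfl, h4.le⟩).1 (not_le.2 hab)
  have hconn : (gen (rejoin f a b) ⊔ gen c) a (f a) := by
    by_contra hcon
    classical
    -- Cut both pairs. By parity the class of `a` contains a second cut end. It cannot be `b` or `f
    -- b`, since either would connect `a` to `b` through `f` and the cups; so it is `f a`.
    let X : Finset (Fin n) := {a, b, f a, f b}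
    have hX : ∀ x, x ∈ X ↔ x = a ∨ x = b ∨ x = f a ∨ x = f b := fun x => by simp [X]
    have hXf : ∀ x, x ∉ X → f x ∉ X := by
      intro x hx
      have := hf.invol x
      have := hf.invol a
      have := hf.invol b
      rw [hX] at hx ⊢
      grind
    let f₀ : Fin n → Fin n := fun x => if x ∈ X then x else f x
    set R := gen f₀ ⊔ gen c with hR
    have hRle : R ≤ gen f ⊔ gen c := by
      refine sup_le (gen_le.2 fun x => ?_) le_sup_right
      simp only [f₀]
      split_ifs
      · exact Setoid.refl' _ _
      · exact (le_sup_left : gen f ≤ _) (gen_apply f x)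
    have hRle' : R ≤ gen (rejoin f a b) ⊔ gen c := by
      refine sup_le (gen_le.2 fun x => ?_) le_sup_right
      simp only [f₀]
      split_ifs with hx
      · exact Setoid.refl' _ _
      · rw [hX] at hx
        push Not at hx
        have := (le_sup_left : gen (rejoin f a b) ≤ gen (rejoin f a b) ⊔ gen c)
          (gen_apply (rejoin f a b) x)
        rwa [rejoin_of_ne hx.1 hx.2.1 hx.2.2.1 hx.2.2.2] at this
    let A : Finset (Fin n) := Finset.univ.filter fun x => R a x
    have hmem : ∀ x, x ∈ A ↔ R a x := fun x => by simp [A]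
    have hev := even_card_inter hf hc A X (by
      intro x hx
      rw [hmem] at hx ⊢
      exact Setoid.trans' _ hx ((le_sup_right : gen c ≤ R) (gen_apply c x))) (by
      intro x hx hxX
      rw [hmem] at hx
      have h3 : R x (f x) := by
        have := (le_sup_left : gen f₀ ≤ R) (gen_apply f₀ x)
        simpa [f₀, hxX] using this
      rw [hmem]
      exact ⟨Setoid.trans' _ hx h3, hXf x hxX⟩)
    have : A ∩ X = {a} := by
      ext x
      rw [Finset.mem_inter, Finset.mem_singleton, hmem, hX]
      constructor
      · rintro ⟨h1, rfl | rfl | rfl | rfl⟩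
        · rfl
        · exact absurd (hRle h1) hdis
        · exact absurd (hRle' h1) hcon
        · refine absurd (Setoid.trans' _ (hRle h1) ?_) hdis
          exact Setoid.symm' _ ((le_sup_left : gen f ≤ _) (gen_apply f b))
      · rintro rfl
        exact ⟨Setoid.refl' _ _, Or.inl rfl⟩
    rw [this] at hev
    simp at hev
  constructor
  · rw [numClasses_of_not hdis, sup_right_comm, gen_sup_link_rejoin hf h, sup_right_comm,
      numClasses_sup_link hconn]
  · have hconn' : (gen (rejoin f a b) ⊔ gen g ⊔ gen c) a (f a) :=
      (sup_le_sup_right le_sup_left _ : gen (rejoin f a b) ⊔ gen c ≤ _) hconn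
    rw [← numClasses_sup_link hconn', sup_right_comm, sup_right_comm _ (gen g),
      ← gen_sup_link_rejoin hf h, sup_assoc (gen f), sup_eq_right.2 (link_le_gen hga)]

/-- Take the shortest pair of `g` that is not a pair of `f`. A disagreement inside it would lie on a
still shorter such pair. -/
lemma exists_innermost (hf : IsMatching f) (hg : IsMatching g) (hgn : Noncrossing g)
    (hne : f ≠ g) : ∃ a, a < g a ∧ f a ≠ g a ∧ ∀ x, a < x → x < g a → f x = g x := by
  classical
  have hswap : ∀ x, f x ≠ g x → f (g x) ≠ g (g x) := by
    intro x hx h'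
    rw [hg.invol] at h'
    have := congrArg f h'
    rw [hf.invol] at this
    exact hx this.symm
  obtain ⟨x, hx⟩ := Function.ne_iff.1 hne
  let Y : Finset (Fin n) := Finset.univ.filter fun a => a < g a ∧ f a ≠ g a
  have hY : ∀ a, a ∈ Y ↔ a < g a ∧ f a ≠ g a := fun a => by simp [Y]
  have hYn : Y.Nonempty := by
    rcases lt_or_gt_of_ne (hg.ne x) with h | h
    · exact ⟨g x, (hY _).2 ⟨by rwa [hg.invol], hswap x hx⟩⟩
    · exact ⟨x, (hY _).2 ⟨h, hx⟩⟩
  obtain ⟨a, ha, hmin⟩ := Finset.exists_min_image Y (fun a => (g a).val - a.val) hYn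
  obtain ⟨ha1, ha2⟩ := (hY a).1 ha
  refine ⟨a, ha1, ha2, fun x h1 h2 => ?_⟩
  by_contra hx
  have h3 := hgn.mem_Ioo hg h1 h2
  rcases lt_or_gt_of_ne (hg.ne x) with h | h
  · have := hmin (g x) ((hY _).2 ⟨by rwa [hg.invol], hswap x hx⟩)
    rw [hg.invol] at this
    simp only [Fin.lt_def] at *
    omega
  · have := hmin x ((hY _).2 ⟨h, hx⟩)
    simp only [Fin.lt_def] at *
    omega

/-- The Euler formula for two noncrossing matchings on the two sides of the equator. -/
theorem euler_formula (hg : IsMatching g) (hgn : Noncrossing g) (hc : IsMatching c)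
    (hcv : IsCups c) (hf : IsMatching f) (hfn : Noncrossing f) :
    2 * (numClasses (gen f ⊔ gen g) + numClasses (gen f ⊔ gen c) + numClasses (gen g ⊔ gen c)) =
      4 * numClasses (gen f ⊔ gen g ⊔ gen c) + n := by
  classical
  induction hk : (Finset.univ.filter fun x => f x ≠ g x).card using Nat.strong_induction_on
    generalizing f with
  | _ k ih =>
    by_cases hfg : f = g
    · subst hfg
      -- For `f = g` the formula reduces to the count of the pairs of one matching.
      have := hf.numClasses_gen
      rw [Fintype.card_fin] at this
      rw [sup_idem]
      omega
    · obtain ⟨a, ha1, ha2, hin⟩ := exists_innermost hf hg hgn hfg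
      have hr := hf.rejoin ha1.ne ha2
      have hgin : ∀ x, a < x → x < g a → a < f x ∧ f x < g a := fun x h1 h2 => by
        rw [hin x h1 h2]; exact hgn.mem_Ioo hg h1 h2
      have hrn := hfn.rejoin hf ha1 ha2 hgin
      have hlt : (Finset.univ.filter fun x => rejoin f a (g a) x ≠ g x).card < k := by
        rw [← hk]
        apply Finset.card_lt_card
        -- Rejoining makes `a` and `g a` agree with `g`. The values also change at `f a` and `f (g
        -- a)`, but there `f` and `g` disagreed already.
        refine ⟨fun x hx => ?_, fun hsub => ?_⟩
        · simp only [Finset.mem_filter, Finset.mem_univ, true_and] at hx ⊢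
          intro hfx
          apply hx
          have h1 := hf.invol x
          have h2 := hf.invol a
          have h3 := hf.invol (g a)
          have h4 := hg.invol x
          have h5 := hg.invol a
          unfold rejoin
          grind
        · have := hsub (show a ∈ _ by simpa using ha2)
          simp [rejoin_left] at this
      have e := ih _ hlt hr hrn rfl
      rw [numClasses_rejoin hf hg ha1.ne ha2 rfl] at e
      -- Rejoining always adds a loop with `g`. For even `a` the counts with `c` and with `g` and
      -- `c` also grow by one; for odd `a` the first drops by one and the second is unchanged.
      rcases Nat.mod_two_eq_zero_or_one a.val with h0 | h1
      · obtain ⟨e1, e2⟩ := euler_step_even hf hg hgn hc hcv ha1 ha2 rfl hin h0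
        omega
      · obtain ⟨e1, e2⟩ := euler_step_odd hf hfn hg hgn hc hcv ha1 ha2 rfl hin h1
        omega

end Euler

/-! ### Connected components of finite unions -/

section Components

variable {E ι : Type*} [TopologicalSpace E] [Finite ι] {Z : ι → Set E}

/-- By finiteness the union of the other pieces is closed too, so a preconnected set cannot meet two
pieces. -/
lemma eq_of_isPreconnected (hcl : ∀ i, IsClosed (Z i)) (hd : Pairwise fun i j => Disjoint (Z i) (Z j))
    {T : Set E} (hT : IsPreconnected T) (hTZ : T ⊆ ⋃ i, Z i) {x y : E} (hx : x ∈ T) (hy : y ∈ T)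
    {i j : ι} (hxi : x ∈ Z i) (hyj : y ∈ Z j) : i = j := by
  by_contra hij
  have hU : IsClosed (⋃ k : {k // k ≠ i}, Z k) := isClosed_iUnion_of_finite fun k => hcl k
  have hdis : Disjoint (Z i) (⋃ k : {k // k ≠ i}, Z k) :=
    Set.disjoint_iUnion_right.2 fun k => hd k.2.symm
  have hcov : T ⊆ Z i ∪ ⋃ k : {k // k ≠ i}, Z k := by
    intro z hz
    obtain ⟨k, hk⟩ := Set.mem_iUnion.1 (hTZ hz)
    by_cases hki : k = i
    · exact Or.inl (hki ▸ hk)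
    · exact Or.inr (Set.mem_iUnion.2 ⟨⟨k, hki⟩, hk⟩)
  have hyU : y ∈ ⋃ k : {k // k ≠ i}, Z k := Set.mem_iUnion.2 ⟨⟨j, Ne.symm hij⟩, hyj⟩
  rcases isPreconnected_iff_subset_of_disjoint_closed.1 hT _ _ (hcl i) hU hcov
    (by rw [hdis.inter_eq, Set.inter_empty]) with h | h
  · exact Set.disjoint_left.1 hdis (h hy) hyU
  · exact Set.disjoint_left.1 hdis hxi (h hx)

/-- A finite disjoint union of closed connected sets has these sets as its components. -/
lemma card_connectedComponents (hcl : ∀ i, IsClosed (Z i))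
    (hd : Pairwise fun i j => Disjoint (Z i) (Z j)) (hcon : ∀ i, IsConnected (Z i)) {X : Set E}
    (hX : X = ⋃ i, Z i) : Nat.card (ConnectedComponents X) = Nat.card ι := by
  subst hX
  choose p hp using fun i => (hcon i).nonempty
  have hpX : ∀ i, p i ∈ ⋃ i, Z i := fun i => Set.mem_iUnion.2 ⟨i, hp i⟩
  symm
  refine Nat.card_congr (Equiv.ofBijective
    (fun i => ((⟨p i, hpX i⟩ : ↥(⋃ i, Z i)) : ConnectedComponents ↥(⋃ i, Z i))) ⟨fun i j hij => ?_, ?_⟩)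
  · have h1 := ConnectedComponents.coe_eq_coe'.1 hij
    have hT := (isPreconnected_connectedComponent (x := (⟨p j, hpX j⟩ : ↥(⋃ i, Z i)))).image
      _ continuous_subtype_val.continuousOn
    refine eq_of_isPreconnected hcl hd hT ?_ ⟨_, h1, rfl⟩ ⟨_, mem_connectedComponent, rfl⟩
      (hp i) (hp j)
    rintro _ ⟨z, -, rfl⟩
    exact z.2
  · intro q
    obtain ⟨⟨x, hx⟩, rfl⟩ := ConnectedComponents.surjective_coe q
    obtain ⟨i, hi⟩ := Set.mem_iUnion.1 hx
    refine ⟨i, ConnectedComponents.coe_eq_coe'.2 ?_⟩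
    have hpre : IsPreconnected (Subtype.val ⁻¹' Z i : Set ↥(⋃ i, Z i)) := by
      rw [← Topology.IsInducing.subtypeVal.isPreconnected_image, Subtype.image_preimage_coe,
        Set.inter_eq_right.2 (Set.subset_iUnion Z i)]
      exact (hcon i).isPreconnected
    have hpi : (⟨p i, hpX i⟩ : ↥(⋃ i, Z i)) ∈ (Subtype.val ⁻¹' Z i : Set ↥(⋃ i, Z i)) := hp i
    exact hpre.subset_connectedComponent (x := ⟨x, hx⟩) hi hpi

end Components

/-! ### Strings of decorated hemispheres -/

variable {m : ℕ} {φ : Fin (2 * m) → ℝ} {ε : ℤˣ}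

lemma eqPt_injective (hφ : StrictMono φ) (hφ' : ∀ i j, φ j - φ i < 2 * Real.pi) :
    Function.Injective fun i => eqPt (φ i) := by
  intro i j hij
  have h0 : Real.cos (φ i) = Real.cos (φ j) := by
    have := congrArg (fun x : E3 => x 0) hij
    simpa [eqPt] using this
  have h1 : Real.sin (φ i) = Real.sin (φ j) := by
    have := congrArg (fun x : E3 => x 1) hij
    simpa [eqPt] using this
  have h2 : Real.cos (φ i - φ j) = 1 := by
    rw [Real.cos_sub, h0, h1]
    nlinarith [Real.sin_sq_add_cos_sq (φ j)]
  have h3 := (Real.cos_eq_one_iff_of_lt_of_lt (by linarith [hφ' i j]) (hφ' j i)).1 h2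
  exact hφ.injective (by linarith)

/-- The strings of a decorated hemisphere: the closed strings `𝒞`, and for every boundary point `i`
the open string `arc i` ending there, whose other end is the boundary point `f i`. -/
structure IsStringData (D : DecHemisphere φ ε) (𝒞 : Finset (Set E3)) (arc : Fin (2 * m) → Set E3)
    (f : Fin (2 * m) → Fin (2 * m)) : Prop where
  matching : IsMatching f
  arc_open : ∀ i, IsOpenString ε (arc i)
  closed : ∀ A ∈ 𝒞, IsClosedString ε A
  mem_arc : ∀ i, eqPt (φ i) ∈ arc i
  arc_mate : ∀ i, arc (f i) = arc i
  disjoint_arc : ∀ i j, j ≠ i → j ≠ f i → Disjoint (arc i) (arc j)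
  disjoint_closed : ∀ A ∈ 𝒞, ∀ B ∈ 𝒞, A ≠ B → Disjoint A B
  disjoint_closed_arc : ∀ A ∈ 𝒞, ∀ i, Disjoint A (arc i)
  union : D.carrier = (⋃ A : 𝒞, A.1) ∪ ⋃ i, arc i

/-- A string through a boundary point is open, since circles avoid the equator. It meets the equator
exactly in its two distinct ends, which are boundary points, and this defines the mate. The strings
that are no such arc are the closed ones. -/
lemma exists_stringData (hφ : StrictMono φ) (hφ' : ∀ i j, φ j - φ i < 2 * Real.pi)
    (D : DecHemisphere φ ε) : ∃ 𝒞 arc f, IsStringData D 𝒞 arc f := by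
  classical
  obtain ⟨𝒮, hfin, hdis, hun, hstr⟩ := D.strings
  have hinj := eqPt_injective hφ hφ'
  have hb : ∀ i, eqPt (φ i) ∈ D.carrier ∩ equator := fun i => by
    rw [D.boundary]; exact ⟨i, rfl⟩
  have hb' : ∀ x ∈ D.carrier, x ∈ equator → ∃ i, eqPt (φ i) = x := fun x h1 h2 => by
    have : x ∈ D.carrier ∩ equator := ⟨h1, h2⟩
    rwa [D.boundary] at this
  have hsub : ∀ A ∈ 𝒮, A ⊆ D.carrier := fun A hA => hun ▸ Set.subset_sUnion_of_mem hA
  have hex : ∀ i, ∃ A ∈ 𝒮, eqPt (φ i) ∈ A := fun i => by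
    have := (hb i).1
    rw [← hun] at this
    exact this
  choose arc harc hmem using hex
  have hsame : ∀ A ∈ 𝒮, ∀ B ∈ 𝒮, ∀ x, x ∈ A → x ∈ B → A = B := fun A hA B hB x hxA hxB => by
    by_contra hne
    exact Set.disjoint_left.1 (hdis hA hB hne) hxA hxB
  have hopen : ∀ i, IsOpenString ε (arc i) := fun i => by
    rcases hstr _ (harc i) with h | ⟨γ, -, h2, -, h4⟩
    · exact h
    · have := hmem i
      rw [← h2] at this
      obtain ⟨t, ht⟩ := this
      exact absurd (ht ▸ (hb i).2) (h4 t)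
  have hmate : ∀ i, ∃ j, j ≠ i ∧ eqPt (φ j) ∈ arc i ∧
      ∀ k, eqPt (φ k) ∈ arc i → k = i ∨ k = j := by
    intro i
    obtain ⟨γ, h1, h2, -, h4⟩ := hopen i
    have hγ : ∀ t, γ t ∈ arc i := fun t => h2 ▸ ⟨t, rfl⟩
    obtain ⟨j0, hj0⟩ := hb' _ (hsub _ (harc i) (hγ 0)) ((h4 0).2 (Or.inl rfl))
    obtain ⟨j1, hj1⟩ := hb' _ (hsub _ (harc i) (hγ 1)) ((h4 1).2 (Or.inr rfl))
    have h01 : j0 ≠ j1 := fun h => by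
      rw [h, hj1] at hj0
      exact zero_ne_one (h1 hj0.symm)
    have hall : ∀ k, eqPt (φ k) ∈ arc i → k = j0 ∨ k = j1 := by
      intro k hk
      rw [← h2] at hk
      obtain ⟨t, ht⟩ := hk
      rcases (h4 t).1 (ht ▸ (hb k).2) with rfl | rfl
      · exact Or.inl (hinj (ht.symm.trans hj0.symm))
      · exact Or.inr (hinj (ht.symm.trans hj1.symm))
    rcases hall i (hmem i) with h | h
    · exact ⟨j1, by rw [h]; exact h01.symm, hj1 ▸ hγ 1, fun k hk => h ▸ hall k hk⟩
    · exact ⟨j0, by rw [h]; exact h01, hj0 ▸ hγ 0, fun k hk => h ▸ (hall k hk).symm⟩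
  choose f hf1 hf2 hf3 using hmate
  have harcf : ∀ i, arc (f i) = arc i := fun i =>
    hsame _ (harc _) _ (harc _) _ (hmem (f i)) (hf2 i)
  have hff : ∀ i, f (f i) = i := fun i => by
    have h : eqPt (φ (f (f i))) ∈ arc i := by
      have := hf2 (f i)
      rwa [harcf i] at this
    exact (hf3 i _ h).resolve_right (hf1 (f i))
  refine ⟨hfin.toFinset.filter fun A => ∀ i, A ≠ arc i, arc, f, ⟨hff, hf1⟩, hopen, ?_, hmem, harcf,
    ?_, ?_, ?_, ?_⟩
  · intro A hA
    rw [Finset.mem_filter, Set.Finite.mem_toFinset] at hA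
    rcases hstr A hA.1 with ⟨γ, -, h2, -, h4⟩ | h
    · have h0 : γ 0 ∈ A := h2 ▸ ⟨0, rfl⟩
      obtain ⟨j, hj⟩ := hb' _ (hsub A hA.1 h0) ((h4 0).2 (Or.inl rfl))
      exact absurd (hsame _ hA.1 _ (harc j) _ h0 (hj ▸ hmem j)) (hA.2 j)
    · exact h
  · intro i j h1 h2
    refine hdis (harc i) (harc j) fun h => ?_
    rcases hf3 i j (h ▸ hmem j) with h3 | h3
    · exact h1 h3
    · exact h2 h3
  · intro A hA B hB hAB
    rw [Finset.mem_filter, Set.Finite.mem_toFinset] at hA hB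
    exact hdis hA.1 hB.1 hAB
  · intro A hA i
    rw [Finset.mem_filter, Set.Finite.mem_toFinset] at hA
    exact hdis hA.1 (harc i) (hA.2 i)
  · apply Set.Subset.antisymm
    · rw [← hun]
      rintro x ⟨A, hA, hx⟩
      by_cases h : ∃ i, A = arc i
      · obtain ⟨i, rfl⟩ := h
        exact Or.inr (Set.mem_iUnion.2 ⟨i, hx⟩)
      · push Not at h
        exact Or.inl (Set.mem_iUnion.2 ⟨⟨A, by
          rw [Finset.mem_filter, Set.Finite.mem_toFinset]; exact ⟨hA, h⟩⟩, hx⟩)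
    · refine Set.union_subset (Set.iUnion_subset fun A => ?_) (Set.iUnion_subset fun i => hsub _ (harc i))
      have := A.2
      rw [Finset.mem_filter, Set.Finite.mem_toFinset] at this
      exact hsub _ this.1

lemma IsOpenString.isClosed {A : Set E3} (h : IsOpenString ε A) : IsClosed A := by
  obtain ⟨γ, -, rfl, -, -⟩ := h
  exact (isCompact_range γ.continuous).isClosed

lemma IsOpenString.isConnected {A : Set E3} (h : IsOpenString ε A) : IsConnected A := by
  obtain ⟨γ, -, rfl, -, -⟩ := h
  exact isConnected_range γ.continuous

lemma IsOpenString.subset {A : Set E3} (h : IsOpenString ε A) : A ⊆ spaceBoundary ε := by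
  obtain ⟨γ, -, -, h, -⟩ := h
  exact h

lemma IsClosedString.isClosed {A : Set E3} (h : IsClosedString ε A) : IsClosed A := by
  obtain ⟨γ, -, rfl, -, -⟩ := h
  exact (isCompact_range γ.continuous).isClosed

lemma IsClosedString.isConnected {A : Set E3} (h : IsClosedString ε A) : IsConnected A := by
  obtain ⟨γ, -, rfl, -, -⟩ := h
  have : ConnectedSpace Circle := Circle.exp_surjective.connectedSpace Circle.exp.continuous
  exact isConnected_range γ.continuous

lemma IsClosedString.subset {A : Set E3} (h : IsClosedString ε A) : A ⊆ spaceBoundary ε := by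
  obtain ⟨γ, -, -, h, -⟩ := h
  exact h

lemma IsClosedString.disjoint_equator {A : Set E3} (h : IsClosedString ε A) :
    Disjoint A equator := by
  obtain ⟨γ, -, rfl, -, h⟩ := h
  rw [Set.disjoint_left]
  rintro _ ⟨t, rfl⟩
  exact h t

lemma mem_equator_of_mem {x : E3} (h1 : x ∈ spaceBoundary ε) (h2 : x ∈ spaceBoundary (-ε)) :
    x ∈ equator := by
  refine ⟨h1.1, ?_⟩
  have a := h1.2
  have b := h2.2
  rcases Int.units_eq_one_or ε with rfl | rfl
  · simp at a b; linarith
  · simp at a b; linarith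

namespace IsStringData

variable {D : DecHemisphere φ ε} {𝒞 : Finset (Set E3)} {arc : Fin (2 * m) → Set E3}
  {f : Fin (2 * m) → Fin (2 * m)}

lemma eq_or_eq_of_mem (h : IsStringData D 𝒞 arc f) {i j : Fin (2 * m)} {x : E3} (hi : x ∈ arc i)
    (hj : x ∈ arc j) : j = i ∨ j = f i := by
  by_contra! hne
  exact Set.disjoint_left.1 (h.disjoint_arc i j hne.1 hne.2) hi hj

lemma noncrossing (hφ : StrictMono φ) (hφ' : ∀ i j, φ j - φ i < 2 * Real.pi)
    (h : IsStringData D 𝒞 arc f) : Noncrossing f := by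
  intro x y h1 h2 h3
  have hinj := eqPt_injective hφ hφ'
  obtain ⟨z, hz1, hz2⟩ := (h.arc_open x).inter_nonempty (h.arc_open y) (hφ h1) (hφ h2) (hφ h3)
    (by linarith [hφ' x (f y)]) (h.mem_arc x) (h.arc_mate x ▸ h.mem_arc (f x)) (h.mem_arc y)
    (h.arc_mate y ▸ h.mem_arc (f y)) (fun h' => h.matching.ne x (hinj h').symm)
    (fun h' => h.matching.ne y (hinj h').symm)
  rcases h.eq_or_eq_of_mem hz1 hz2 with h' | h'
  · exact h1.ne' h'
  · exact h2.ne h'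

lemma exists_of_mem_equator (h : IsStringData D 𝒞 arc f) {i : Fin (2 * m)} {x : E3}
    (hx : x ∈ arc i) (hxe : x ∈ equator) : ∃ j, gen f i j ∧ x = eqPt (φ j) := by
  have hxc : x ∈ D.carrier ∩ equator := by
    refine ⟨?_, hxe⟩
    rw [h.union]
    exact Or.inr (Set.mem_iUnion.2 ⟨i, hx⟩)
  rw [D.boundary] at hxc
  obtain ⟨j, rfl⟩ := hxc
  exact ⟨j, h.matching.gen_iff.2 (h.eq_or_eq_of_mem hx (h.mem_arc j)), rfl⟩

/-- The mirror fixes the equator pointwise, so it keeps the matching and the number of closed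
strings. -/
lemma reflect (h : IsStringData D 𝒞 arc f) :
    ∃ 𝒞' arc', 𝒞'.card = 𝒞.card ∧ IsStringData D.reflect 𝒞' arc' f := by
  classical
  have hinj : Function.Injective fun A : Set E3 => mirror '' A :=
    Set.image_injective.2 mirror_injective
  refine ⟨𝒞.image fun A => mirror '' A, fun i => mirror '' arc i,
    Finset.card_image_of_injective _ hinj, h.matching, fun i => (h.arc_open i).mirror, ?_, ?_, ?_,
    ?_, ?_, ?_, ?_⟩
  · intro A hA
    obtain ⟨B, hB, rfl⟩ := Finset.mem_image.1 hA
    exact (h.closed B hB).mirror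
  · exact fun i => ⟨_, h.mem_arc i, mirror_eqPt _⟩
  · exact fun i => congrArg _ (h.arc_mate i)
  · exact fun i j h1 h2 => (Set.disjoint_image_iff mirror_injective).2 (h.disjoint_arc i j h1 h2)
  · intro A hA A' hA' hne
    obtain ⟨B, hB, rfl⟩ := Finset.mem_image.1 hA
    obtain ⟨B', hB', rfl⟩ := Finset.mem_image.1 hA'
    exact (Set.disjoint_image_iff mirror_injective).2
      (h.disjoint_closed B hB B' hB' fun h' => hne (congrArg _ h'))
  · intro A hA i
    obtain ⟨B, hB, rfl⟩ := Finset.mem_image.1 hA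
    exact (Set.disjoint_image_iff mirror_injective).2 (h.disjoint_closed_arc B hB i)
  · change mirror '' D.carrier = _
    rw [h.union, Set.image_union, Set.image_iUnion, Set.image_iUnion]
    congr 1
    ext x
    simp only [Set.mem_iUnion]
    constructor
    · rintro ⟨A, hA⟩
      exact ⟨⟨_, Finset.mem_image_of_mem _ A.2⟩, hA⟩
    · rintro ⟨⟨A, hA⟩, hx⟩
      obtain ⟨B, hB, rfl⟩ := Finset.mem_image.1 hA
      exact ⟨⟨B, hB⟩, hx⟩

/-- The strings of one hemisphere, sorted by their end points. -/
lemma eq_of_joined (h : IsStringData D 𝒞 arc f) {T : Set E3} (hT : IsPreconnected T)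
    (hTD : T ⊆ D.carrier) {x y : E3} (hx : x ∈ T) (hy : y ∈ T)
    {p q : 𝒞 ⊕ Quotient (gen f)}
    (hxp : x ∈ Sum.elim (fun A : 𝒞 => A.1) (fun q => ⋃ i : {i // Quotient.mk (gen f) i = q}, arc i) p)
    (hyq : y ∈ Sum.elim (fun A : 𝒞 => A.1) (fun q => ⋃ i : {i // Quotient.mk (gen f) i = q}, arc i) q) :
    p = q := by
  refine eq_of_isPreconnected (Z := Sum.elim (fun A : 𝒞 => A.1)
    (fun q => ⋃ i : {i // Quotient.mk (gen f) i = q}, arc i)) ?_ ?_ hT ?_ hx hy hxp hyq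
  · rintro (A | q)
    · exact (h.closed A.1 A.2).isClosed
    · exact isClosed_iUnion_of_finite fun i => (h.arc_open i).isClosed
  · rintro (A | p) (B | q) hne
    · exact h.disjoint_closed _ A.2 _ B.2 fun h' => hne (congrArg _ (Subtype.ext h'))
    · exact Set.disjoint_iUnion_right.2 fun i => h.disjoint_closed_arc _ A.2 _
    · exact Set.disjoint_iUnion_left.2 fun i => (h.disjoint_closed_arc _ B.2 _).symm
    · refine Set.disjoint_iUnion_left.2 fun i => Set.disjoint_iUnion_right.2 fun j => ?_
      refine Set.disjoint_left.2 fun z hi hj => hne (congrArg _ ?_)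
      rw [← i.2, ← j.2]
      exact Quotient.sound (h.matching.gen_iff.2 (h.eq_or_eq_of_mem hi hj))
  · refine hTD.trans ?_
    rw [h.union]
    rintro z (hz | hz)
    · obtain ⟨A, hA⟩ := Set.mem_iUnion.1 hz
      exact Set.mem_iUnion.2 ⟨Sum.inl A, hA⟩
    · obtain ⟨i, hi⟩ := Set.mem_iUnion.1 hz
      exact Set.mem_iUnion.2 ⟨Sum.inr (Quotient.mk _ i), Set.mem_iUnion.2 ⟨⟨i, rfl⟩, hi⟩⟩

/-- The image of a path is connected and stays in one string. -/
lemma gen_of_joinedIn (h : IsStringData D 𝒞 arc f) {i j : Fin (2 * m)}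
    (hij : JoinedIn D.carrier (eqPt (φ i)) (eqPt (φ j))) : gen f i j := by
  obtain ⟨γ, hγ⟩ := hij
  have := h.eq_of_joined (isPreconnected_range γ.continuous)
    (by rintro _ ⟨t, rfl⟩; exact hγ t) ⟨0, γ.source⟩ ⟨1, γ.target⟩
    (p := Sum.inr (Quotient.mk _ i)) (q := Sum.inr (Quotient.mk _ j))
    (Set.mem_iUnion.2 ⟨⟨i, rfl⟩, h.mem_arc i⟩) (Set.mem_iUnion.2 ⟨⟨j, rfl⟩, h.mem_arc j⟩)
  exact Quotient.exact (Sum.inr_injective this)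

lemma closed_eq_empty (h : IsStringData D 𝒞 arc f)
    (hD : ∀ x ∈ D.carrier, ∃ i, JoinedIn D.carrier x (eqPt (φ i))) : 𝒞 = ∅ := by
  rw [Finset.eq_empty_iff_forall_notMem]
  intro A hA
  obtain ⟨x, hx⟩ := (h.closed A hA).isConnected.nonempty
  have hxD : x ∈ D.carrier := by
    rw [h.union]
    exact Or.inl (Set.mem_iUnion.2 ⟨⟨A, hA⟩, hx⟩)
  obtain ⟨i, γ, hγ⟩ := hD x hxD
  have := h.eq_of_joined (isPreconnected_range γ.continuous)
    (by rintro _ ⟨t, rfl⟩; exact hγ t) ⟨0, γ.source⟩ ⟨1, γ.target⟩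
    (p := Sum.inl ⟨A, hA⟩) (q := Sum.inr (Quotient.mk _ i))
    hx (Set.mem_iUnion.2 ⟨⟨i, rfl⟩, h.mem_arc i⟩)
  exact Sum.inl_ne_inr this

/-- The closed strings of the union of two decorated hemispheres. -/
lemma card_components (h : IsStringData D 𝒞 arc f) {D' : DecHemisphere φ (-ε)}
    {𝒞' : Finset (Set E3)} {arc' : Fin (2 * m) → Set E3} {f' : Fin (2 * m) → Fin (2 * m)}
    (h' : IsStringData D' 𝒞' arc' f') :
    Nat.card (ConnectedComponents ↥(D'.carrier ∪ D.carrier)) =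
      𝒞'.card + 𝒞.card + numClasses (gen f' ⊔ gen f) := by
  set R := gen f' ⊔ gen f with hR
  let Z : (𝒞' ⊕ 𝒞) ⊕ Quotient R → Set E3 := Sum.elim (Sum.elim (fun A => A.1) (fun A => A.1))
    (fun q => ⋃ i : {i // Quotient.mk R i = q}, (arc' i ∪ arc i))
  have hcc : ∀ A ∈ 𝒞', ∀ B ∈ 𝒞, Disjoint A B := fun A hA B hB =>
    Set.disjoint_left.2 fun z hz hz' => Set.disjoint_left.1 (h.closed B hB).disjoint_equator hz'
      (mem_equator_of_mem ((h.closed B hB).subset hz') ((h'.closed A hA).subset hz))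
  have hca : ∀ A ∈ 𝒞', ∀ i, Disjoint A (arc i) := fun A hA i =>
    Set.disjoint_left.2 fun z hz hz' => Set.disjoint_left.1 (h'.closed A hA).disjoint_equator hz
      (mem_equator_of_mem ((h.arc_open i).subset hz') ((h'.closed A hA).subset hz))
  have hac : ∀ A ∈ 𝒞, ∀ i, Disjoint A (arc' i) := fun A hA i =>
    Set.disjoint_left.2 fun z hz hz' => Set.disjoint_left.1 (h.closed A hA).disjoint_equator hz
      (mem_equator_of_mem ((h.closed A hA).subset hz) ((h'.arc_open i).subset hz'))
  -- Arcs of opposite hemispheres meet only on the equator, hence only in common boundary points.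
  have haa : ∀ i j z, z ∈ arc' i → z ∈ arc j → R i j := by
    intro i j z hi hj
    have hz := mem_equator_of_mem ((h.arc_open j).subset hj) ((h'.arc_open i).subset hi)
    obtain ⟨k, hk, rfl⟩ := h.exists_of_mem_equator hj hz
    refine Setoid.trans' _ ((le_sup_left : gen f' ≤ R) (h'.matching.gen_iff.2
      (h'.eq_or_eq_of_mem hi (h'.mem_arc k)))) (Setoid.symm' _ ((le_sup_right : gen f ≤ R) hk))
  have key := card_connectedComponents (Z := Z) (X := D'.carrier ∪ D.carrier) ?_ ?_ ?_ ?_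
  · rw [key, Nat.card_sum, Nat.card_sum, numClasses]
    simp
  · rintro ((A | A) | q)
    · exact (h'.closed A.1 A.2).isClosed
    · exact (h.closed A.1 A.2).isClosed
    · exact isClosed_iUnion_of_finite fun i => (h'.arc_open i).isClosed.union (h.arc_open i).isClosed
  · rintro ((A | A) | p) ((B | B) | q) hne
    · exact h'.disjoint_closed _ A.2 _ B.2 fun e => hne (by rw [Subtype.ext e])
    · exact hcc _ A.2 _ B.2
    · exact Set.disjoint_iUnion_right.2 fun i =>
        Set.disjoint_union_right.2 ⟨h'.disjoint_closed_arc _ A.2 _, hca _ A.2 _⟩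
    · exact (hcc _ B.2 _ A.2).symm
    · exact h.disjoint_closed _ A.2 _ B.2 fun e => hne (by rw [Subtype.ext e])
    · exact Set.disjoint_iUnion_right.2 fun i =>
        Set.disjoint_union_right.2 ⟨hac _ A.2 _, h.disjoint_closed_arc _ A.2 _⟩
    · exact Set.disjoint_iUnion_left.2 fun i =>
        (Set.disjoint_union_right.2 ⟨h'.disjoint_closed_arc _ B.2 _, hca _ B.2 _⟩).symm
    · exact Set.disjoint_iUnion_left.2 fun i =>
        (Set.disjoint_union_right.2 ⟨hac _ B.2 _, h.disjoint_closed_arc _ B.2 _⟩).symm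
    · refine Set.disjoint_iUnion_left.2 fun i => Set.disjoint_iUnion_right.2 fun j => ?_
      refine Set.disjoint_left.2 fun z hi hj => hne (congrArg _ ?_)
      rw [← i.2, ← j.2]
      refine Quotient.sound ?_
      change R i.1 j.1
      rcases hi with hi | hi <;> rcases hj with hj | hj
      · exact (le_sup_left : gen f' ≤ R) (h'.matching.gen_iff.2 (h'.eq_or_eq_of_mem hi hj))
      · exact haa _ _ _ hi hj
      · exact Setoid.symm' _ (haa _ _ _ hj hi)
      · exact (le_sup_right : gen f ≤ R) (h.matching.gen_iff.2 (h.eq_or_eq_of_mem hi hj))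
  · rintro ((A | A) | q)
    · exact (h'.closed A.1 A.2).isConnected
    · exact (h.closed A.1 A.2).isConnected
    · obtain ⟨i₀, hi₀⟩ := Quotient.exists_rep q
      have hsub : ∀ j, Quotient.mk R j = q → arc' j ∪ arc j ⊆ Z (Sum.inr q) := fun j hj =>
        Set.subset_iUnion (fun i : {i // Quotient.mk R i = q} => arc' i ∪ arc i) ⟨j, hj⟩
      have hpre : ∀ j, IsPreconnected (arc' j ∪ arc j) := fun j =>
        (h'.arc_open j).isConnected.isPreconnected.union _ (h'.mem_arc j) (h.mem_arc j)
          (h.arc_open j).isConnected.isPreconnected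
      -- Connectedness of a loop: lying in the component of the base point is preserved by both
      -- matchings, hence along the whole class.
      let W : Set E3 := connectedComponentIn (Z (Sum.inr q)) (eqPt (φ i₀))
      have hW : ∀ j, Quotient.mk R j = q → eqPt (φ j) ∈ W → arc' j ∪ arc j ⊆ W := by
        intro j hj hjW
        have := (hpre j).subset_connectedComponentIn (Or.inl (h'.mem_arc j)) (hsub j hj)
        rwa [← connectedComponentIn_eq hjW] at this
      have hstep : ∀ g : Fin (2 * m) → Fin (2 * m), (∀ x, g (g x) = x) → (∀ x, R x (g x)) →
          (∀ j, eqPt (φ (g j)) ∈ arc' j ∪ arc j) →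
          gen g ≤ Setoid.ker fun j => Quotient.mk R j = q ∧ eqPt (φ j) ∈ W := by
        intro g hg hgR hga
        refine gen_le_ker hg fun j hj => ⟨?_, hW j hj.1 hj.2 (hga j)⟩
        rw [← hj.1]
        exact Quotient.sound (Setoid.symm' _ (hgR j))
      have hRW : R ≤ Setoid.ker fun j => Quotient.mk R j = q ∧ eqPt (φ j) ∈ W := by
        refine sup_le (hstep f' h'.matching.invol (gen_le.1 le_sup_left) fun j => Or.inl ?_)
          (hstep f h.matching.invol (gen_le.1 le_sup_right) fun j => Or.inr ?_)
        · have := h'.mem_arc (f' j); rwa [h'.arc_mate] at this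
        · have := h.mem_arc (f j); rwa [h.arc_mate] at this
      have h00 : eqPt (φ i₀) ∈ W :=
        mem_connectedComponentIn (hsub i₀ hi₀ (Or.inl (h'.mem_arc i₀)))
      have hall : Z (Sum.inr q) ⊆ W := by
        refine Set.iUnion_subset fun j => ?_
        have hj : R i₀ j.1 := Quotient.exact (hi₀.trans j.2.symm)
        exact hW j j.2 ((iff_of_le_ker hRW hj).1 ⟨hi₀, h00⟩).2
      have : Z (Sum.inr q) = W := hall.antisymm (connectedComponentIn_subset _ _)
      rw [this]
      exact isConnected_connectedComponentIn_iff.2 (connectedComponentIn_subset _ _ h00)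
  · apply Set.Subset.antisymm
    · rw [h.union, h'.union]
      rintro z ((hz | hz) | (hz | hz)) <;> obtain ⟨i, hi⟩ := Set.mem_iUnion.1 hz
      · exact Set.mem_iUnion.2 ⟨Sum.inl (Sum.inl i), hi⟩
      · exact Set.mem_iUnion.2 ⟨Sum.inr (Quotient.mk _ i), Set.mem_iUnion.2 ⟨⟨i, rfl⟩, Or.inl hi⟩⟩
      · exact Set.mem_iUnion.2 ⟨Sum.inl (Sum.inr i), hi⟩
      · exact Set.mem_iUnion.2 ⟨Sum.inr (Quotient.mk _ i), Set.mem_iUnion.2 ⟨⟨i, rfl⟩, Or.inr hi⟩⟩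
    · rw [h.union, h'.union]
      refine Set.iUnion_subset ?_
      rintro ((A | A) | q)
      · exact fun z hz => Or.inl (Or.inl (Set.mem_iUnion.2 ⟨A, hz⟩))
      · exact fun z hz => Or.inr (Or.inl (Set.mem_iUnion.2 ⟨A, hz⟩))
      · refine Set.iUnion_subset fun i => ?_
        rintro z (hz | hz)
        · exact Or.inl (Or.inr (Set.mem_iUnion.2 ⟨i, hz⟩))
        · exact Or.inr (Or.inr (Set.mem_iUnion.2 ⟨i, hz⟩))

end IsStringData

/-! ### Chords over the equatorial disc -/

/-- The lift to a hemisphere of the chord between two points of the equator. -/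
def chordPt (ε : ℤˣ) (a b t : ℝ) : E3 :=
  !₂[(1 - t) * Real.cos a + t * Real.cos b, (1 - t) * Real.sin a + t * Real.sin b,
    ((ε : ℤ) : ℝ) * √(2 * (t * (1 - t)) * (1 - Real.cos (a - b)))]

/-- The open string over a chord. -/
def chord (ε : ℤˣ) (a b : ℝ) : Set E3 := (fun t : unitInterval => chordPt ε a b t) '' Set.univ

lemma continuous_chordPt (ε : ℤˣ) (a b : ℝ) : Continuous (chordPt ε a b) := by
  unfold chordPt
  fun_prop

lemma unit_sq_cast (ε : ℤˣ) : ((ε : ℤ) : ℝ) * ((ε : ℤ) : ℝ) = 1 := by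
  rcases Int.units_eq_one_or ε with rfl | rfl <;> simp

lemma chordPt_zero (ε : ℤˣ) (a b : ℝ) : chordPt ε a b 0 = eqPt a := by
  simp [chordPt, eqPt]

lemma chordPt_one (ε : ℤˣ) (a b : ℝ) : chordPt ε a b 1 = eqPt b := by
  simp [chordPt, eqPt]

lemma chordPt_mem_spaceBoundary (ε : ℤˣ) (a b : ℝ) (t : unitInterval) :
    chordPt ε a b t ∈ spaceBoundary ε := by
  have h0 : 0 ≤ 2 * ((t : ℝ) * (1 - t)) * (1 - Real.cos (a - b)) := by
    have := t.2.1
    have := sub_nonneg.2 t.2.2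
    have := sub_nonneg.2 (Real.cos_le_one (a - b))
    positivity
  refine ⟨mem_sph_iff.2 ?_, ?_⟩
  · simp only [chordPt, PiLp.toLp_apply, Matrix.cons_val_zero, Matrix.cons_val_one, Matrix.cons_val]
    -- The squared norm of the planar part is `1 - 2 t (1 - t) (1 - cos (a - b))`; the height
    -- supplies the rest.
    rw [mul_pow, Real.sq_sqrt h0, sq ((ε : ℤ) : ℝ), unit_sq_cast, Real.cos_sub]
    linear_combination (1 - (t : ℝ)) ^ 2 * Real.sin_sq_add_cos_sq a +
      (t : ℝ) ^ 2 * Real.sin_sq_add_cos_sq b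
  · simp only [chordPt, PiLp.toLp_apply, Matrix.cons_val]
    rw [← mul_assoc, unit_sq_cast, one_mul]
    exact Real.sqrt_nonneg _

lemma chordPt_mem_equator (ε : ℤˣ) {a b : ℝ} (hab : Real.cos (a - b) ≠ 1) (t : unitInterval) :
    chordPt ε a b t ∈ equator ↔ t = 0 ∨ t = 1 := by
  constructor
  · intro h
    have h2 := h.2
    simp only [chordPt, PiLp.toLp_apply, Matrix.cons_val] at h2
    have h3 : √(2 * ((t : ℝ) * (1 - t)) * (1 - Real.cos (a - b))) = 0 :=
      (mul_eq_zero.1 h2).resolve_left (by simp)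
    have h5 := sub_nonneg.2 t.2.2
    have h6 := sub_pos.2 (lt_of_le_of_ne (Real.cos_le_one (a - b)) hab)
    rw [Real.sqrt_eq_zero (mul_nonneg (mul_nonneg zero_le_two (mul_nonneg t.2.1 h5)) h6.le)] at h3
    rcases mul_eq_zero.1 h3 with h3 | h3
    · rcases mul_eq_zero.1 ((mul_eq_zero.1 h3).resolve_left two_ne_zero) with h3 | h3
      · exact Or.inl (Subtype.ext h3)
      · exact Or.inr (Subtype.ext (by simpa using (sub_eq_zero.1 h3).symm))
    · exact absurd h3 h6.ne'
  · rintro (rfl | rfl)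
    · rw [Set.Icc.coe_zero, chordPt_zero]; exact eqPt_mem_equator a
    · rw [Set.Icc.coe_one, chordPt_one]; exact eqPt_mem_equator b

lemma isOpenString_chord (ε : ℤˣ) {a b : ℝ} (hab : Real.cos (a - b) ≠ 1) :
    IsOpenString ε (chord ε a b) := by
  refine ⟨⟨fun t => chordPt ε a b t, (continuous_chordPt ε a b).comp continuous_subtype_val⟩,
    fun s t hst => ?_, Set.image_univ.symm, ?_, chordPt_mem_equator ε hab⟩
  · have h0 : chordPt ε a b s 0 = chordPt ε a b t 0 := congrArg (fun x : E3 => x 0) hst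
    have h1 : chordPt ε a b s 1 = chordPt ε a b t 1 := congrArg (fun x : E3 => x 1) hst
    simp only [chordPt, PiLp.toLp_apply, Matrix.cons_val_zero, Matrix.cons_val_one] at h0 h1
    by_contra hne
    have hne' : (s : ℝ) - t ≠ 0 := sub_ne_zero.2 fun h => hne (Subtype.ext h)
    have e0 : Real.cos b = Real.cos a := by
      have : ((s : ℝ) - t) * (Real.cos b - Real.cos a) = 0 := by linarith
      exact sub_eq_zero.1 ((mul_eq_zero.1 this).resolve_left hne')
    have e1 : Real.sin b = Real.sin a := by
      have : ((s : ℝ) - t) * (Real.sin b - Real.sin a) = 0 := by linarith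
      exact sub_eq_zero.1 ((mul_eq_zero.1 this).resolve_left hne')
    apply hab
    rw [Real.cos_sub, e0, e1]
    nlinarith [Real.sin_sq_add_cos_sq a]
  · rintro _ ⟨t, -, rfl⟩
    exact chordPt_mem_spaceBoundary ε a b t

lemma left_mem_chord (ε : ℤˣ) (a b : ℝ) : eqPt a ∈ chord ε a b :=
  ⟨0, trivial, by simp [chordPt_zero]⟩

lemma right_mem_chord (ε : ℤˣ) (a b : ℝ) : eqPt b ∈ chord ε a b :=
  ⟨1, trivial, by simp [chordPt_one]⟩

lemma joinedIn_chord (ε : ℤˣ) (a b : ℝ) {x y : E3} (hx : x ∈ chord ε a b) (hy : y ∈ chord ε a b) :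
    JoinedIn (chord ε a b) x y := by
  have : PathConnectedSpace unitInterval := isPathConnected_iff_pathConnectedSpace.1
    ((convex_Icc (0 : ℝ) 1).isPathConnected (Set.nonempty_Icc.2 zero_le_one))
  have : IsPathConnected (chord ε a b) := isPathConnected_univ.image
    ((continuous_chordPt ε a b).comp continuous_subtype_val)
  exact this.joinedIn _ hx _ hy

/-- The affine function that vanishes on the line through the points at the angles `a` and `b`. -/
def side (a b : ℝ) (x : E3) : ℝ :=
  x 0 * Real.cos ((a + b) / 2) + x 1 * Real.sin ((a + b) / 2) - Real.cos ((b - a) / 2)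

lemma side_eqPt (a b t : ℝ) :
    side a b (eqPt t) = Real.cos (t - (a + b) / 2) - Real.cos ((b - a) / 2) := by
  simp [side, eqPt, Real.cos_sub]

lemma side_chordPt (ε : ℤˣ) (a b c d t : ℝ) :
    side a b (chordPt ε c d t) = (1 - t) * side a b (eqPt c) + t * side a b (eqPt d) := by
  simp [side, eqPt, chordPt]
  ring

lemma side_self_left (a b : ℝ) : side a b (eqPt a) = 0 := by
  rw [side_eqPt, ← Real.cos_neg, sub_eq_zero]
  congr 1
  ring

lemma side_self_right (a b : ℝ) : side a b (eqPt b) = 0 := by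
  rw [side_eqPt, sub_eq_zero]
  congr 1
  ring

lemma side_pos {a b t : ℝ} (hab : b - a < 2 * Real.pi) (h1 : a < t) (h2 : t < b) :
    0 < side a b (eqPt t) := by
  rw [side_eqPt, sub_pos, ← Real.cos_abs (t - _)]
  apply Real.cos_lt_cos_of_nonneg_of_le_pi (abs_nonneg _) (by linarith)
  rw [abs_lt]
  constructor <;> linarith

lemma side_neg_of_gt {a b t : ℝ} (hab : a < b) (h1 : b < t) (h2 : t - a < 2 * Real.pi) :
    side a b (eqPt t) < 0 := by
  rw [side_eqPt, sub_neg]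
  -- The cosine decreases only up to `π`; beyond that the angle is replaced by `2π` minus itself.
  rcases le_total (t - (a + b) / 2) Real.pi with h | h
  · exact Real.cos_lt_cos_of_nonneg_of_le_pi (by linarith) h (by linarith)
  · rw [← Real.cos_two_pi_sub]
    exact Real.cos_lt_cos_of_nonneg_of_le_pi (by linarith) (by linarith) (by linarith)

lemma side_neg_of_lt {a b t : ℝ} (hab : a < b) (h1 : t < a) (h2 : b - t < 2 * Real.pi) :
    side a b (eqPt t) < 0 := by
  have := side_neg_of_gt (a := -b) (b := -a) (t := -t) (by linarith) (by linarith) (by linarith)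
  rw [side_eqPt] at this ⊢
  rw [← Real.cos_neg (-t - _)] at this
  convert! this using 3 <;> ring

/-- The function `side a b` is affine along the second chord with end values of equal sign, so it
has no zero there, while it vanishes on the first chord. -/
lemma disjoint_chord_of_pos {ε : ℤˣ} {a b c d : ℝ} (h : 0 < side a b (eqPt c) * side a b (eqPt d)) :
    Disjoint (chord ε a b) (chord ε c d) := by
  rw [Set.disjoint_left]
  rintro _ ⟨s, -, rfl⟩ ⟨t, -, ht⟩
  have h0 := side_chordPt ε a b a b s
  have h1 := side_chordPt ε a b c d t
  rw [side_self_left, side_self_right, mul_zero, mul_zero, add_zero] at h0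
  have h2 : (1 - (t : ℝ)) * side a b (eqPt c) + t * side a b (eqPt d) = 0 := by
    rw [← h1, ← h0]; exact congrArg _ ht
  have t0 := t.2.1
  have t1 := sub_nonneg.2 t.2.2
  have h3 : (1 - (t : ℝ)) * side a b (eqPt c) ^ 2 +
      t * (side a b (eqPt c) * side a b (eqPt d)) = 0 := by
    linear_combination side a b (eqPt c) * h2
  have h4 := mul_nonneg t1 (sq_nonneg (side a b (eqPt c)))
  have h5 := mul_nonneg t0 h.le
  have h6 : (t : ℝ) = 0 := (mul_eq_zero.1 (by linarith)).resolve_right h.ne'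
  rw [h6] at h2
  rw [show side a b (eqPt c) = 0 by linarith, zero_mul] at h
  exact lt_irrefl _ h


lemma disjoint_chord (hφ : StrictMono φ) (hφ' : ∀ i j, φ j - φ i < 2 * Real.pi) (ε : ℤˣ)
    {x y z w : Fin (2 * m)} (hxy : x < y)
    (h : ((x < z ∧ z < y) ∧ (x < w ∧ w < y)) ∨ ((z < x ∨ y < z) ∧ (w < x ∨ y < w))) :
    Disjoint (chord ε (φ x) (φ y)) (chord ε (φ z) (φ w)) := by
  have hneg : ∀ v, (v < x ∨ y < v) → side (φ x) (φ y) (eqPt (φ v)) < 0 := by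
    rintro v (hv | hv)
    · exact side_neg_of_lt (hφ hxy) (hφ hv) (hφ' _ _)
    · exact side_neg_of_gt (hφ hxy) (hφ hv) (hφ' _ _)
  apply disjoint_chord_of_pos
  rcases h with ⟨⟨h1, h2⟩, h3, h4⟩ | ⟨h1, h2⟩
  · exact mul_pos (side_pos (hφ' _ _) (hφ h1) (hφ h2)) (side_pos (hφ' _ _) (hφ h3) (hφ h4))
  · exact mul_pos_of_neg_of_neg (hneg _ h1) (hneg _ h2)

/-! ### The reconnected cups as chord diagrams -/

lemma exists_block_end {t : ℕ → Prop} {m i : ℕ} (ht : ∀ k, t k → k + 1 < m) (hi : i < m) :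
    ∃ j, i ≤ j ∧ j < m ∧ (∀ k, i ≤ k → k < j → t k) ∧ ¬ t j := by
  classical
  -- Cup `m - 1` has no site to its right, so every block ends there at the latest.
  have hex : ∃ j, i ≤ j ∧ ¬ t j := ⟨m - 1, by omega, fun h => by have := ht _ h; omega⟩
  refine ⟨Nat.find hex, (Nat.find_spec hex).1, ?_, fun k h1 h2 => ?_, (Nat.find_spec hex).2⟩
  · have := Nat.find_min' hex (m := m - 1) ⟨by omega, fun h => by have := ht _ h; omega⟩
    omega
  · by_contra h
    exact Nat.find_min hex h2 ⟨h1, h⟩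

lemma exists_block_start (t : ℕ → Prop) (j : ℕ) :
    ∃ i, i ≤ j ∧ (∀ k, i ≤ k → k < j → t k) ∧ ∀ k, k + 1 = i → ¬ t k := by
  induction j with
  | zero => exact ⟨0, le_rfl, fun k _ h => absurd h (by omega), fun k h => by omega⟩
  | succ j ih =>
    by_cases hj : t j
    · obtain ⟨i, h1, h2, h3⟩ := ih
      refine ⟨i, by omega, fun k hk hk' => ?_, h3⟩
      rcases Nat.lt_succ_iff_lt_or_eq.1 hk' with h | rfl
      · exact h2 k hk h
      · exact hj
    · exact ⟨j + 1, le_rfl, fun k h1 h2 => by omega, fun k hk => by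
        obtain rfl : k = j := by omega
        exact hj⟩

/-- The site `k` belongs to `T`. -/
def site (T : Finset (Fin (m - 1))) (k : ℕ) : Prop := ∃ h : k < m - 1, (⟨k, h⟩ : Fin (m - 1)) ∈ T

lemma site_lt {T : Finset (Fin (m - 1))} {k : ℕ} (h : site T k) : k + 1 < m := by
  obtain ⟨h, -⟩ := h
  omega

lemma site_val {T : Finset (Fin (m - 1))} {k : Fin (m - 1)} : site T k.val ↔ k ∈ T :=
  ⟨fun h => h.2, fun h => ⟨k.2, h⟩⟩

/-- The cups `i, …, j` form a maximal block linked by sites in `T`. -/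
def IsBlock (t : ℕ → Prop) (i j : ℕ) : Prop :=
  i ≤ j ∧ (∀ k, i ≤ k → k < j → t k) ∧ (∀ k, k + 1 = i → ¬ t k) ∧ ¬ t j

/-- The pairs of the diagram reconnected at the sites in `T`. -/
def IsCupPair (t : ℕ → Prop) (x y : ℕ) : Prop :=
  (∃ k, t k ∧ x = 2 * k + 1 ∧ y = 2 * k + 2) ∨ ∃ i j, IsBlock t i j ∧ x = 2 * i ∧ y = 2 * j + 1

lemma IsCupPair.lt {t : ℕ → Prop} {x y : ℕ} (h : IsCupPair t x y) : x < y := by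
  rcases h with ⟨k, -, rfl, rfl⟩ | ⟨i, j, h, rfl, rfl⟩
  · omega
  · have := h.1; omega

lemma IsCupPair.nested {t : ℕ → Prop} {x y z w : ℕ} (h : IsCupPair t x y) (h' : IsCupPair t z w)
    (hne : ¬ (x = z ∧ y = w)) :
    ((x < z ∧ z < y) ∧ (x < w ∧ w < y)) ∨ ((z < x ∨ y < z) ∧ (w < x ∨ y < w)) := by
  -- A site of `t` is interior to a block or away from it, never at its border, and distinct blocks
  -- are disjoint. The remaining cases are arithmetic.
  have key : ∀ k i j, t k → IsBlock t i j → (i ≤ k ∧ k < j) ∨ k + 1 < i ∨ j < k := by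
    rintro k i j hk ⟨h1, h2, h3, h4⟩
    have a : k + 1 ≠ i := fun h => h3 k h hk
    have b : k ≠ j := fun h => h4 (h ▸ hk)
    omega
  have key2 : ∀ i j i' j', IsBlock t i j → IsBlock t i' j' → i < i' → j < i' := by
    rintro i j i' j' ⟨h1, h2, h3, h4⟩ ⟨h1', h2', h3', h4'⟩ hlt
    by_contra hcon
    exact h3' (i' - 1) (by omega) (h2 _ (by omega) (by omega))
  have key3 : ∀ i j j', IsBlock t i j → IsBlock t i j' → ¬ j < j' := by
    rintro i j j' ⟨h1, h2, h3, h4⟩ ⟨h1', h2', h3', h4'⟩ hlt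
    exact h4 (h2' _ h1 hlt)
  rcases h with ⟨k, hk, rfl, rfl⟩ | ⟨i, j, hb, rfl, rfl⟩ <;>
    rcases h' with ⟨k', hk', rfl, rfl⟩ | ⟨i', j', hb', rfl, rfl⟩
  · omega
  · have := key k i' j' hk hb'
    have := hb'.1
    omega
  · have := key k' i j hk' hb
    have := hb.1
    omega
  · have := hb.1
    have := hb'.1
    rcases lt_trichotomy i i' with h | h | h
    · have := key2 _ _ _ _ hb hb' h
      omega
    · subst h
      have := key3 _ _ _ hb hb'
      have := key3 _ _ _ hb' hb
      omega
    · have := key2 _ _ _ _ hb' hb h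
      omega

lemma exists_isCupPair {t : ℕ → Prop} {m x : ℕ} (ht : ∀ k, t k → k + 1 < m) (hx : x < 2 * m) :
    ∃ y < 2 * m, IsCupPair t x y ∨ IsCupPair t y x := by
  rcases Nat.even_or_odd' x with ⟨i, rfl | rfl⟩
  · by_cases h : ∃ k, k + 1 = i ∧ t k
    · obtain ⟨k, rfl, hk⟩ := h
      exact ⟨2 * k + 1, by omega, Or.inr (Or.inl ⟨k, hk, rfl, by ring⟩)⟩
    · push Not at h
      obtain ⟨j, h1, h2, h3, h4⟩ := exists_block_end (i := i) ht (by omega)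
      exact ⟨2 * j + 1, by omega, Or.inl (Or.inr ⟨i, j, ⟨h1, h3, h, h4⟩, rfl, rfl⟩)⟩
  · by_cases h : t i
    · exact ⟨2 * i + 2, by have := ht i h; omega, Or.inl (Or.inl ⟨i, h, rfl, rfl⟩)⟩
    · obtain ⟨i', h1, h2, h3⟩ := exists_block_start t i
      exact ⟨2 * i', by omega, Or.inr (Or.inr ⟨i', i, ⟨h1, h2, h3, h⟩, rfl, rfl⟩)⟩

lemma isBlock_of_fin {T : Finset (Fin (m - 1))} {i j : Fin m} (hij : i ≤ j)
    (h1 : ∀ k : Fin (m - 1), i.val ≤ k.val → k.val < j.val → k ∈ T)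
    (h2 : ∀ k : Fin (m - 1), k.val + 1 = i.val → k ∉ T)
    (h3 : ∀ k : Fin (m - 1), k.val = j.val → k ∉ T) : IsBlock (site T) i.val j.val :=
  ⟨hij, fun k hk hk' => ⟨by omega, h1 ⟨k, by omega⟩ hk hk'⟩,
    fun k hk hs => h2 ⟨k, hs.1⟩ hk hs.2, fun hs => h3 ⟨j.val, hs.1⟩ rfl hs.2⟩

/-- The diagram of chords reconnected at the sites in `T`. -/
theorem exists_isCupDiagram (hφ : StrictMono φ) (hφ' : ∀ i j, φ j - φ i < 2 * Real.pi) (ε : ℤˣ)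
    (T : Finset (Fin (m - 1))) : ∃ D : DecHemisphere φ ε, IsCupDiagram T D := by
  let P : Fin (2 * m) × Fin (2 * m) → Prop := fun p => IsCupPair (site T) p.1.val p.2.val
  let ch : Fin (2 * m) × Fin (2 * m) → Set E3 := fun p => chord ε (φ p.1) (φ p.2)
  let 𝒮 : Set (Set E3) := ch '' {p | P p}
  have hcos : ∀ p, P p → Real.cos (φ p.1 - φ p.2) ≠ 1 := by
    intro p hp h
    have := (Real.cos_eq_one_iff_of_lt_of_lt (by linarith [hφ' p.1 p.2]) (hφ' p.2 p.1)).1 h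
    exact hp.lt.ne (congrArg Fin.val (hφ.injective (sub_eq_zero.1 this)))
  have hopen : ∀ p, P p → IsOpenString ε (ch p) := fun p hp => isOpenString_chord ε (hcos p hp)
  let D : DecHemisphere φ ε :=
    { carrier := ⋃₀ 𝒮
      strings := by
        refine ⟨𝒮, Set.toFinite _, ?_, rfl, ?_⟩
        · rintro _ ⟨p, hp, rfl⟩ _ ⟨q, hq, rfl⟩ hne
          refine disjoint_chord hφ hφ' ε (IsCupPair.lt hp) (IsCupPair.nested hp hq fun h => hne ?_)
          rw [show p = q from Prod.ext (Fin.ext h.1) (Fin.ext h.2)]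
        · rintro _ ⟨p, hp, rfl⟩
          exact Or.inl (hopen p hp)
      boundary := by
        apply Set.Subset.antisymm
        · rintro x ⟨⟨_, ⟨p, hp, rfl⟩, t, -, rfl⟩, hx⟩
          rcases (chordPt_mem_equator ε (hcos p hp) t).1 hx with rfl | rfl
          · exact ⟨p.1, by simp [chordPt_zero]⟩
          · exact ⟨p.2, by simp [chordPt_one]⟩
        · rintro _ ⟨x, rfl⟩
          refine ⟨?_, eqPt_mem_equator _⟩
          obtain ⟨y, hy, h | h⟩ := exists_isCupPair (fun k => site_lt (T := T)) x.2
          · exact ⟨_, ⟨(x, ⟨y, hy⟩), h, rfl⟩, left_mem_chord ε _ _⟩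
          · exact ⟨_, ⟨(⟨y, hy⟩, x), h, rfl⟩, right_mem_chord ε _ _⟩ }
  have hjoin : ∀ p, P p → JoinedIn D.carrier (eqPt (φ p.1)) (eqPt (φ p.2)) := fun p hp =>
    (joinedIn_chord ε _ _ (left_mem_chord ε _ _) (right_mem_chord ε _ _)).mono
      (Set.subset_sUnion_of_mem ⟨p, hp, rfl⟩)
  refine ⟨D, ?_, ?_, ?_⟩
  · rintro x ⟨_, ⟨p, hp, rfl⟩, hx⟩
    exact ⟨p.1, (joinedIn_chord ε _ _ hx (left_mem_chord ε _ _)).mono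
      (Set.subset_sUnion_of_mem ⟨p, hp, rfl⟩)⟩
  · exact fun k hk => hjoin (_, _) (Or.inl ⟨k, site_val.2 hk, rfl, rfl⟩)
  · exact fun i j hij h1 h2 h3 =>
      hjoin (_, _) (Or.inr ⟨i, j, isBlock_of_fin hij h1 h2 h3, rfl, rfl⟩)


/-! ### Chains of cups -/

section Chains

/-- The matching of the `m` cups. -/
def cupMap (m : ℕ) (x : Fin (2 * m)) : Fin (2 * m) :=
  ⟨if x.val % 2 = 0 then x.val + 1 else x.val - 1, by have := x.2; split_ifs <;> omega⟩

lemma isCups_cupMap (m : ℕ) : IsCups (cupMap m) := fun _ => rfl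

lemma isMatching_cupMap (m : ℕ) : IsMatching (cupMap m) := by
  constructor
  · intro x
    apply Fin.ext
    simp only [cupMap]
    split_ifs <;> omega
  · intro x h
    have := congrArg Fin.val h
    simp only [cupMap] at this
    split_ifs at this <;> omega

/-- The connection of the cups `k` and `k + 1`. -/
def siteLink (k : Fin (m - 1)) : Setoid (Fin (2 * m)) :=
  link ⟨2 * k.val + 1, by omega⟩ ⟨2 * k.val + 2, by omega⟩

/-- The equivalence relation generated by the cups and the connections at the sites in `T`. -/
def chain (T : Finset (Fin (m - 1))) : Setoid (Fin (2 * m)) := gen (cupMap m) ⊔ T.sup siteLink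

lemma chain_union (T T' : Finset (Fin (m - 1))) : chain T ⊔ chain T' = chain (T ∪ T') := by
  rw [chain, chain, chain, Finset.sup_union, ← sup_sup_distrib_left]

/-- The `m` cups lie in a row, and every link merges two classes: neither the cups nor the links at
other sites cross the gap between the points `2k + 1` and `2k + 2`. -/
lemma numClasses_chain (T : Finset (Fin (m - 1))) : numClasses (chain T) + T.card = m := by
  induction T using Finset.induction_on with
  | empty =>
    have := (isMatching_cupMap m).numClasses_gen
    rw [Fintype.card_fin] at this
    rw [chain, Finset.sup_empty, sup_bot_eq, Finset.card_empty]
    omega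
  | insert k T hk ih =>
    have hnot : ¬ chain T ⟨2 * k.val + 1, by omega⟩ ⟨2 * k.val + 2, by omega⟩ := by
      intro h
      have hle : chain T ≤ Setoid.ker fun x : Fin (2 * m) => x.val ≤ 2 * k.val + 1 := by
        refine sup_le (gen_le_ker (isMatching_cupMap m).invol fun x hx => ?_)
          (Finset.sup_le fun j hj => link_le.2 ?_)
        · simp only [cupMap]
          split_ifs <;> omega
        · have : j.val ≠ k.val := fun h => hk (Fin.ext h ▸ hj)
          change (_ : Prop) = _
          apply propext
          change 2 * j.val + 1 ≤ 2 * k.val + 1 ↔ 2 * j.val + 2 ≤ 2 * k.val + 1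
          omega
      have := (iff_of_le_ker hle h).1 (le_refl (2 * k.val + 1))
      simp at this
    have := numClasses_of_not hnot
    rw [Finset.card_insert_of_notMem hk, chain, Finset.sup_insert, sup_comm (siteLink k), ← sup_assoc]
    change numClasses (chain T ⊔ link _ _) + _ = m
    omega

lemma chain_of_site {T : Finset (Fin (m - 1))} {k : ℕ} (hk : site T k) :
    chain T ⟨2 * k + 1, by have := site_lt hk; omega⟩ ⟨2 * k + 2, by have := site_lt hk; omega⟩ := by
  obtain ⟨h1, h2⟩ := hk
  exact link_le.1 ((Finset.le_sup (f := siteLink) h2).trans le_sup_right)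

lemma chain_of_cup (T : Finset (Fin (m - 1))) {k : ℕ} (hk : k < m) :
    chain T ⟨2 * k, by omega⟩ ⟨2 * k + 1, by omega⟩ := by
  have h := (le_sup_left : gen (cupMap m) ≤ chain T) (gen_apply (cupMap m) ⟨2 * k, by omega⟩)
  have h2 : cupMap m ⟨2 * k, by omega⟩ = ⟨2 * k + 1, by omega⟩ := by simp [cupMap]
  rwa [h2] at h

lemma chain_of_block {T : Finset (Fin (m - 1))} {i j : ℕ} (hij : i ≤ j) (hj : j < m)
    (h : ∀ k, i ≤ k → k < j → site T k) :
    chain T ⟨2 * i, by omega⟩ ⟨2 * j + 1, by omega⟩ := by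
  induction j, hij using Nat.le_induction with
  | base => exact chain_of_cup T hj
  | succ j hij ih =>
    refine Setoid.trans' _ (ih (by omega) fun k h1 h2 => h k h1 (by omega)) ?_
    exact Setoid.trans' _ (chain_of_site (h j hij (by omega))) (chain_of_cup T hj)

/-- Every point lies in a prescribed pair, so the diagram determines `f`. Inner pairs are links of
the chain, and the outer pair of a block joins the ends of a linked run of cups. -/
lemma IsCupDiagram.gen_sup {D : DecHemisphere φ ε} {T : Finset (Fin (m - 1))}
    (hD : IsCupDiagram T D) {𝒞 : Finset (Set E3)} {arc : Fin (2 * m) → Set E3}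
    {f : Fin (2 * m) → Fin (2 * m)} (h : IsStringData D 𝒞 arc f) :
    gen f ⊔ gen (cupMap m) = chain T := by
  have key : ∀ (x y : Fin (2 * m)), IsCupPair (site T) x.val y.val → f x = y ∧ chain T x y := by
    rintro ⟨x, hx⟩ ⟨y, hy⟩ hxy
    have hne := hxy.lt
    simp only at hne
    have hf : ∀ (h : gen f ⟨x, hx⟩ ⟨y, hy⟩), f ⟨x, hx⟩ = ⟨y, hy⟩ := by
      intro h'
      rcases h.matching.gen_iff.1 h' with h' | h'
      · exact absurd (congrArg Fin.val h') hne.ne'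
      · exact h'.symm
    rcases hxy with ⟨k, hk, rfl, rfl⟩ | ⟨i, j, ⟨h1, h2, h3, h4⟩, rfl, rfl⟩
    · exact ⟨hf (h.gen_of_joinedIn (hD.inner ⟨k, hk.1⟩ hk.2)), chain_of_site hk⟩
    · refine ⟨hf (h.gen_of_joinedIn (hD.outer ⟨i, by omega⟩ ⟨j, by omega⟩ h1 ?_ ?_ ?_)),
        chain_of_block h1 (by omega) h2⟩
      · exact fun k hk hk' => site_val.1 (h2 k hk hk')
      · exact fun k hk hk' => h3 k hk (site_val.2 hk')
      · exact fun k hk hk' => h4 (by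
          have := site_val.2 hk'
          rwa [show k.val = j from hk] at this)
  apply le_antisymm
  · refine sup_le (gen_le.2 fun x => ?_) le_sup_left
    obtain ⟨y, hy, hxy | hxy⟩ := exists_isCupPair (fun k => site_lt (T := T)) x.2
    · obtain ⟨h1, h2⟩ := key x ⟨y, hy⟩ hxy
      rwa [h1]
    · obtain ⟨h1, h2⟩ := key ⟨y, hy⟩ x hxy
      rw [← h1, h.matching.invol, h1]
      exact Setoid.symm' _ h2
  · refine sup_le le_sup_right ((Finset.sup_le fun k hk => link_le.2 ?_).trans le_sup_left)
    exact h.gen_of_joinedIn (hD.inner k hk)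

end Chains

/-! ### Sign sums and spin vectors -/

section Algebra

/-- The inner sum factors over `S'` into terms `2 - 1` or `1 - 1` and becomes the indicator of `S' ⊆
T`. The alternating sum over `S' ⊆ T ⊆ S` that remains vanishes unless `S = S'`. -/
lemma sum_charge_signs {α : Type*} [DecidableEq α] (S S' : Finset α) :
    ∑ T ∈ S.powerset, ∑ T' ∈ S'.powerset,
      ((-1 : ℂ) ^ (S \ T).card * (-1) ^ (S' \ T').card * 2 ^ (T ∩ T').card) =
      if S = S' then 1 else 0 := by
  have h1 : ∀ T : Finset α, ∑ T' ∈ S'.powerset, ((-1 : ℂ) ^ (S' \ T').card * 2 ^ (T ∩ T').card) =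
      if S' ⊆ T then 1 else 0 := by
    intro T
    have h := Finset.prod_add (fun k => if k ∈ T then (2 : ℂ) else 1) (fun _ => -1) S'
    have h2 : ∀ k ∈ S', (if k ∈ T then (2 : ℂ) else 1) + -1 = if k ∈ T then 1 else 0 := by
      intro k _
      split_ifs <;> norm_num
    rw [Finset.prod_congr rfl h2, Finset.prod_ite_zero, Finset.prod_const_one] at h
    refine Eq.trans ?_ (h.symm.trans (if_congr Iff.rfl rfl rfl))
    refine Finset.sum_congr rfl fun T' _ => ?_
    rw [Finset.prod_const, Finset.prod_ite, Finset.prod_const, Finset.prod_const, one_pow, mul_one,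
      mul_comm, Finset.filter_mem_eq_inter, Finset.inter_comm]
  have h3 : ∀ T ∈ S.powerset, ∑ T' ∈ S'.powerset,
      ((-1 : ℂ) ^ (S \ T).card * (-1) ^ (S' \ T').card * 2 ^ (T ∩ T').card) =
      (-1 : ℂ) ^ (S \ T).card * if S' ⊆ T then 1 else 0 := by
    intro T _
    rw [← h1, Finset.mul_sum]
    exact Finset.sum_congr rfl fun T' _ => by ring
  rw [Finset.sum_congr rfl h3]
  by_cases hS : S' ⊆ S
  · have h := Finset.prod_add (fun _ => (1 : ℂ)) (fun k => if k ∉ S' then (-1 : ℂ) else 0) S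
    have h2 : ∀ k ∈ S, (1 : ℂ) + (if k ∉ S' then (-1 : ℂ) else 0) = if k ∈ S' then 1 else 0 := by
      intro k _
      by_cases hk : k ∈ S' <;> simp [hk]
    rw [Finset.prod_congr rfl h2, Finset.prod_ite_zero, Finset.prod_const_one] at h
    have h4 : (∀ k ∈ S, k ∈ S') ↔ S = S' :=
      ⟨fun h => Finset.Subset.antisymm h hS, fun h => h ▸ fun k hk => hk⟩
    refine Eq.trans ?_ (h.symm.trans (if_congr h4 rfl rfl))
    refine Finset.sum_congr rfl fun T hT => ?_
    rw [Finset.prod_const_one, one_mul, Finset.prod_ite_zero, Finset.prod_const, mul_ite, mul_one,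
      mul_zero]
    have h5 : (S' ⊆ T) ↔ ∀ k ∈ S \ T, k ∉ S' := by
      constructor
      · intro h k hk hk'
        exact (Finset.mem_sdiff.1 hk).2 (h hk')
      · intro h k hk
        by_contra hkT
        exact h k (Finset.mem_sdiff.2 ⟨hS hk, hkT⟩) hk
    simp only [h5]
  · rw [if_neg (show ¬ S = S' from fun h => hS h.ge)]
    refine Finset.sum_eq_zero fun T hT => ?_
    rw [if_neg (show ¬ S' ⊆ T from fun h => hS (h.trans (Finset.mem_powerset.1 hT))), mul_zero]

open scoped Classical in
/-- The vector of spin configurations that represents a diagram with the pairs of `f` and `k`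
closed strings. -/
def feature (m : ℕ) (f : Fin (2 * m) → Fin (2 * m)) (k : ℕ) (s : Fin (2 * m) → Bool) : ℝ :=
  if gen f ⊔ gen (cupMap m) ≤ Setoid.ker s then
    √2 ^ k * (√2 ^ numClasses (gen f ⊔ gen (cupMap m)))⁻¹ else 0

lemma sqrt_two_ne_zero : √(2 : ℝ) ≠ 0 := (Real.sqrt_pos.2 two_pos).ne'

/-- Both features are nonzero exactly on the `2 ^ N(f ∨ g ∨ c)` spins constant on the classes of the
join; the Euler formula turns this count and the normalizations into `√2 ^ N(f ∨ g)`. -/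
lemma sum_feature {f g : Fin (2 * m) → Fin (2 * m)} (hf : IsMatching f) (hfn : Noncrossing f)
    (hg : IsMatching g) (hgn : Noncrossing g) (k l : ℕ) :
    √2 ^ m * ∑ s, feature m f k s * feature m g l s = √2 ^ (k + l + numClasses (gen f ⊔ gen g)) := by
  classical
  set F := gen f ⊔ gen (cupMap m) with hF
  set G := gen g ⊔ gen (cupMap m) with hG
  have h1 : ∀ s, feature m f k s * feature m g l s =
      if gen f ⊔ gen g ⊔ gen (cupMap m) ≤ Setoid.ker s then
        √2 ^ k * (√2 ^ numClasses F)⁻¹ * (√2 ^ l * (√2 ^ numClasses G)⁻¹) else 0 := by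
    intro s
    have h2 : (F ≤ Setoid.ker s ∧ G ≤ Setoid.ker s) ↔
        gen f ⊔ gen g ⊔ gen (cupMap m) ≤ Setoid.ker s := by
      rw [← sup_le_iff, hF, hG, ← sup_sup_distrib_right]
    rw [feature, feature, ite_zero_mul_ite_zero]
    exact if_congr h2 rfl rfl
  rw [Finset.sum_congr rfl fun s _ => h1 s, ← Finset.sum_filter, Finset.sum_const, card_le_ker,
    nsmul_eq_mul]
  have he := euler_formula hg hgn (isMatching_cupMap m) (isCups_cupMap m) hf hfn
  rw [← hF, ← hG] at he
  have he' : numClasses (gen f ⊔ gen g) + numClasses F + numClasses G =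
      2 * numClasses (gen f ⊔ gen g ⊔ gen (cupMap m)) + m := by omega
  have h2 : √2 ^ numClasses (gen f ⊔ gen g) * √2 ^ numClasses F * √2 ^ numClasses G =
      2 ^ numClasses (gen f ⊔ gen g ⊔ gen (cupMap m)) * √2 ^ m := by
    rw [← pow_add, ← pow_add, he', pow_add, pow_mul, Real.sq_sqrt zero_le_two]
  have h3 := pow_ne_zero (numClasses F) sqrt_two_ne_zero
  have h4 := pow_ne_zero (numClasses G) sqrt_two_ne_zero
  push_cast
  rw [pow_add, pow_add]
  field_simp
  linear_combination -h2

end Algebra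

/-! ### The form as an inner product of spin vectors -/

/-- The matching of a decorated hemisphere. -/
def mate (hφ : StrictMono φ) (hφ' : ∀ i j, φ j - φ i < 2 * Real.pi) (D : DecHemisphere φ ε) :
    Fin (2 * m) → Fin (2 * m) :=
  (exists_stringData hφ hφ' D).choose_spec.choose_spec.choose

/-- The number of closed strings of a decorated hemisphere. -/
def closedCount (hφ : StrictMono φ) (hφ' : ∀ i j, φ j - φ i < 2 * Real.pi)
    (D : DecHemisphere φ ε) : ℕ :=
  (exists_stringData hφ hφ' D).choose.card

lemma exists_stringData_mate (hφ : StrictMono φ) (hφ' : ∀ i j, φ j - φ i < 2 * Real.pi)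
    (D : DecHemisphere φ ε) :
    ∃ 𝒞 arc, 𝒞.card = closedCount hφ hφ' D ∧ IsStringData D 𝒞 arc (mate hφ hφ' D) :=
  ⟨_, _, rfl, (exists_stringData hφ hφ' D).choose_spec.choose_spec.choose_spec⟩

lemma IsStringData.partitionFunction_eq (hφ : StrictMono φ) (hφ' : ∀ i j, φ j - φ i < 2 * Real.pi)
    {D : DecHemisphere φ ε} {𝒞 : Finset (Set E3)} {arc : Fin (2 * m) → Set E3}
    {f : Fin (2 * m) → Fin (2 * m)} (h : IsStringData D 𝒞 arc f) {D' : DecHemisphere φ (-ε)}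
    {𝒞' : Finset (Set E3)} {arc' : Fin (2 * m) → Set E3} {f' : Fin (2 * m) → Fin (2 * m)}
    (h' : IsStringData D' 𝒞' arc' f') :
    partitionFunction (D'.carrier ∪ D.carrier) =
      ((√2 ^ m : ℝ) : ℂ) * ∑ s, ((feature m f' 𝒞'.card s : ℝ) : ℂ) * ((feature m f 𝒞.card s : ℝ) : ℂ) := by
  have := sum_feature h'.matching (h'.noncrossing hφ hφ') h.matching (h.noncrossing hφ hφ')
    𝒞'.card 𝒞.card
  rw [partitionFunction, h.card_components h', ← Complex.ofReal_pow, ← this]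
  push_cast
  rfl

/-- The representation of decorated hemispheres by functions of spin configurations. -/
def spinMap (hφ : StrictMono φ) (hφ' : ∀ i j, φ j - φ i < 2 * Real.pi) (ε : ℤˣ) :
    V φ ε →ₗ[ℂ] ((Fin (2 * m) → Bool) → ℂ) :=
  Finsupp.linearCombination ℂ fun (D : DecHemisphere φ ε) s =>
    ((feature m (mate hφ hφ' D) (closedCount hφ hφ' D) s : ℝ) : ℂ)

lemma spinMap_single (hφ : StrictMono φ) (hφ' : ∀ i j, φ j - φ i < 2 * Real.pi)
    (D : DecHemisphere φ ε) (a : ℂ) (s : Fin (2 * m) → Bool) :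
    spinMap hφ hφ' ε (Finsupp.single D a) s =
      a * ((feature m (mate hφ hφ' D) (closedCount hφ hφ' D) s : ℝ) : ℂ) := by
  simp [spinMap]

lemma pairing_single_single (D' : DecHemisphere φ (-ε)) (D : DecHemisphere φ ε) (a b : ℂ) :
    pairing φ ε (Finsupp.single D' a) (Finsupp.single D b) =
      a * b * partitionFunction (D'.carrier ∪ D.carrier) := by
  simp [pairing, mul_assoc]

lemma reflection_single (D : DecHemisphere φ ε) (a : ℂ) :
    reflection φ ε (Finsupp.single D a) = Finsupp.single D.reflect (conj a) := by
  change ((Finsupp.single D a).mapRange (starRingEnd ℂ) (map_zero _)).mapDomain _ = _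
  rw [Finsupp.mapRange_single, Finsupp.mapDomain_single]

lemma pairing_single_left (hφ : StrictMono φ) (hφ' : ∀ i j, φ j - φ i < 2 * Real.pi)
    (D' : DecHemisphere φ (-ε)) (a : ℂ) (w : V φ ε) :
    pairing φ ε (Finsupp.single D' a) w = ((√2 ^ m : ℝ) : ℂ) * ∑ s,
      spinMap hφ hφ' (-ε) (Finsupp.single D' a) s * spinMap hφ hφ' ε w s := by
  induction w using Finsupp.induction_linear with
  | zero => simp
  | add v w hv hw =>
    rw [map_add, hv, hw, map_add, ← mul_add, ← Finset.sum_add_distrib]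
    simp only [Pi.add_apply, mul_add]
  | single D b =>
    obtain ⟨𝒞, arc, h1, h⟩ := exists_stringData_mate hφ hφ' D
    obtain ⟨𝒞', arc', h1', h'⟩ := exists_stringData_mate hφ hφ' D'
    rw [pairing_single_single, h.partitionFunction_eq hφ hφ' h', h1, h1', mul_left_comm,
      Finset.mul_sum]
    simp only [spinMap_single]
    congr 1
    exact Finset.sum_congr rfl fun s _ => by ring

/-- The form `⟨θ v, w⟩` is a multiple of the standard inner product of the spin vectors. -/
lemma pairing_reflection (hφ : StrictMono φ) (hφ' : ∀ i j, φ j - φ i < 2 * Real.pi) (v w : V φ ε) :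
    pairing φ ε (reflection φ ε v) w = ((√2 ^ m : ℝ) : ℂ) * ∑ s,
      conj (spinMap hφ hφ' ε v s) * spinMap hφ hφ' ε w s := by
  induction v using Finsupp.induction_linear with
  | zero => simp
  | add v v' hv hv' =>
    rw [map_add, map_add, LinearMap.add_apply, hv, hv', map_add, ← mul_add, ← Finset.sum_add_distrib]
    simp only [Pi.add_apply, map_add, add_mul]
  | single D a =>
    induction w using Finsupp.induction_linear with
    | zero => simp
    | add v w hv hw =>
      rw [map_add, hv, hw, map_add, ← mul_add, ← Finset.sum_add_distrib]
      simp only [Pi.add_apply, mul_add]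
    | single E b =>
      obtain ⟨𝒞, arc, h1, h⟩ := exists_stringData_mate hφ hφ' E
      obtain ⟨𝒞₀, arc₀, h0, h₀⟩ := exists_stringData_mate hφ hφ' D
      obtain ⟨𝒞', arc', h1', h'⟩ := h₀.reflect
      rw [reflection_single, pairing_single_single, h.partitionFunction_eq hφ hφ' h', h1, h1', h0,
        mul_left_comm, Finset.mul_sum]
      simp only [spinMap_single, map_mul, Complex.conj_ofReal]
      congr 1
      exact Finset.sum_congr rfl fun s _ => by ring

lemma sqrt_two_pow_ne_zero (m : ℕ) : ((√2 ^ m : ℝ) : ℂ) ≠ 0 :=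
  Complex.ofReal_ne_zero.2 (pow_ne_zero _ sqrt_two_ne_zero)

lemma sum_conj_mul_self {ι : Type*} [Fintype ι] (g : ι → ℂ) :
    ∑ s, conj (g s) * g s = ((∑ s, Complex.normSq (g s) : ℝ) : ℂ) := by
  rw [Complex.ofReal_sum]
  exact Finset.sum_congr rfl fun s _ => (Complex.normSq_eq_conj_mul_self).symm

lemma eq_zero_of_sum_normSq {ι : Type*} [Fintype ι] {g : ι → ℂ}
    (h : ∑ s, Complex.normSq (g s) = 0) : g = 0 := by
  funext s
  exact Complex.normSq_eq_zero.1
    ((Finset.sum_eq_zero_iff_of_nonneg fun s _ => Complex.normSq_nonneg (g s)).1 h s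
      (Finset.mem_univ s))

/-- Pairing a kernel vector with its own reflection gives a positive multiple of a sum of squares;
conversely every pairing factors through `spinMap`. -/
lemma formKernel_eq_ker (hφ : StrictMono φ) (hφ' : ∀ i j, φ j - φ i < 2 * Real.pi) :
    formKernel φ ε = LinearMap.ker (spinMap hφ hφ' ε) := by
  ext v
  rw [formKernel, LinearMap.mem_ker, LinearMap.mem_ker]
  constructor
  · intro h
    have h1 : pairing φ ε (reflection φ ε v) v = 0 := by
      have := LinearMap.congr_fun h (reflection φ ε v)
      simpa using this
    rw [pairing_reflection hφ hφ', mul_eq_zero, or_iff_right (sqrt_two_pow_ne_zero m),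
      sum_conj_mul_self, Complex.ofReal_eq_zero] at h1
    exact eq_zero_of_sum_normSq h1
  · intro h
    refine Finsupp.lhom_ext fun D' a => ?_
    rw [LinearMap.flip_apply, pairing_single_left hφ hφ', h]
    simp

/-- The representation of the quotient by functions of spin configurations. -/
def spinQuot (hφ : StrictMono φ) (hφ' : ∀ i j, φ j - φ i < 2 * Real.pi) (ε : ℤˣ) :
    VTilde φ ε →ₗ[ℂ] ((Fin (2 * m) → Bool) → ℂ) :=
  (formKernel φ ε).liftQ (spinMap hφ hφ' ε) (formKernel_eq_ker hφ hφ').le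

lemma spinQuot_injective (hφ : StrictMono φ) (hφ' : ∀ i j, φ j - φ i < 2 * Real.pi) :
    Function.Injective (spinQuot hφ hφ' ε) := by
  rw [← LinearMap.ker_eq_bot, spinQuot]
  exact Submodule.ker_liftQ_eq_bot _ _ _ (formKernel_eq_ker hφ hφ').ge

/-- The inner product on the quotient. -/
@[reducible] def innerCore (hφ : StrictMono φ) (hφ' : ∀ i j, φ j - φ i < 2 * Real.pi) (ε : ℤˣ) :
    InnerProductSpace.Core ℂ (VTilde φ ε) where
  inner x y := ((√2 ^ m : ℝ) : ℂ) *
    ∑ s, conj (spinQuot hφ hφ' ε x s) * spinQuot hφ hφ' ε y s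
  conj_inner_symm x y := by
    rw [map_mul, Complex.conj_ofReal, map_sum]
    congr 1
    exact Finset.sum_congr rfl fun s _ => by rw [map_mul, Complex.conj_conj, mul_comm]
  re_inner_nonneg x := by
    rw [sum_conj_mul_self, ← Complex.ofReal_mul]
    exact mul_nonneg (by positivity) (Finset.sum_nonneg fun s _ => Complex.normSq_nonneg _)
  add_left x y z := by
    rw [map_add, ← mul_add, ← Finset.sum_add_distrib]
    simp only [Pi.add_apply, map_add, add_mul]
  smul_left x y r := by
    rw [map_smul]
    simp only [Pi.smul_apply, smul_eq_mul, map_mul, mul_assoc]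
    rw [← Finset.mul_sum, mul_left_comm]
  definite x h := by
    rw [mul_eq_zero, or_iff_right (sqrt_two_pow_ne_zero m), sum_conj_mul_self,
      Complex.ofReal_eq_zero] at h
    exact spinQuot_injective hφ hφ' ((eq_zero_of_sum_normSq h).trans (map_zero _).symm)

lemma innerCore_mkQ (hφ : StrictMono φ) (hφ' : ∀ i j, φ j - φ i < 2 * Real.pi) (v w : V φ ε) :
    (innerCore hφ hφ' ε).inner ((formKernel φ ε).mkQ v) ((formKernel φ ε).mkQ w) =
      pairing φ ε (reflection φ ε v) w :=
  (pairing_reflection hφ hφ' v w).symm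

/-! ### The upper bound for the dimension -/

section Dimension

/-- The sites at which the spin changes. -/
def walls (s : Fin (2 * m) → Bool) : Finset (Fin (m - 1)) :=
  Finset.univ.filter fun k =>
    s ⟨2 * k.val + 1, by omega⟩ ≠ s ⟨2 * k.val + 2, by omega⟩

/-- The exclusive or of the two configurations is constant on the full chain, which has `m - (m - 1)
= 1` class. -/
lemma eq_or_eq_not_of_walls (hm : 1 ≤ m) {s s' : Fin (2 * m) → Bool}
    (hs : gen (cupMap m) ≤ Setoid.ker s) (hs' : gen (cupMap m) ≤ Setoid.ker s')
    (h : walls s = walls s') : s' = s ∨ s' = fun x => !(s x) := by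
  let d : Fin (2 * m) → Bool := fun x => xor (s x) (s' x)
  have hd : chain (Finset.univ : Finset (Fin (m - 1))) ≤ Setoid.ker d := by
    refine sup_le (gen_le.2 fun x => ?_) (Finset.sup_le fun k _ => link_le.2 ?_)
    · have h1 : s x = s (cupMap m x) := gen_le.1 hs x
      have h2 : s' x = s' (cupMap m x) := gen_le.1 hs' x
      change xor _ _ = xor _ _
      rw [h1, h2]
    · have h1 := Finset.ext_iff.1 h k
      simp only [walls, Finset.mem_filter, Finset.mem_univ, true_and] at h1
      change xor _ _ = xor _ _
      revert h1
      generalize s ⟨2 * k.val + 1, by omega⟩ = a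
      generalize s ⟨2 * k.val + 2, by omega⟩ = b
      generalize s' ⟨2 * k.val + 1, by omega⟩ = a'
      generalize s' ⟨2 * k.val + 2, by omega⟩ = b'
      revert a b a' b'
      decide
  have hN := numClasses_chain (Finset.univ : Finset (Fin (m - 1)))
  rw [Finset.card_univ, Fintype.card_fin] at hN
  have h1 : numClasses (chain (Finset.univ : Finset (Fin (m - 1)))) = 1 := by omega
  have hsub : Subsingleton (Quotient (chain (Finset.univ : Finset (Fin (m - 1))))) :=
    (Nat.card_eq_one_iff_unique.1 h1).1
  let x₀ : Fin (2 * m) := ⟨0, by omega⟩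
  have hconst : ∀ x, d x₀ = d x := fun x => hd (Quotient.exact (hsub.elim _ _))
  cases h0 : d x₀ with
  | false =>
    left
    funext x
    have := (hconst x).symm.trans h0
    simp only [d] at this
    revert this
    cases s x <;> cases s' x <;> simp
  | true =>
    right
    funext x
    have := (hconst x).symm.trans h0
    simp only [d] at this
    revert this
    cases s x <;> cases s' x <;> simp

lemma spinMap_eq_of_feature (hφ : StrictMono φ) (hφ' : ∀ i j, φ j - φ i < 2 * Real.pi)
    {s s' : Fin (2 * m) → Bool} (h : ∀ f k, feature m f k s = feature m f k s') (v : V φ ε) :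
    spinMap hφ hφ' ε v s = spinMap hφ hφ' ε v s' := by
  induction v using Finsupp.induction_linear with
  | zero => simp
  | add v w hv hw => simp only [map_add, Pi.add_apply, hv, hw]
  | single D a => rw [spinMap_single, spinMap_single, h]

lemma spinMap_eq_zero (hφ : StrictMono φ) (hφ' : ∀ i j, φ j - φ i < 2 * Real.pi)
    {s : Fin (2 * m) → Bool} (h : ¬ gen (cupMap m) ≤ Setoid.ker s) (v : V φ ε) :
    spinMap hφ hφ' ε v s = 0 := by
  induction v using Finsupp.induction_linear with
  | zero => simp
  | add v w hv hw => simp only [map_add, Pi.add_apply, hv, hw, add_zero]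
  | single D a =>
    rw [spinMap_single, feature, if_neg fun h' => h (le_sup_right.trans h')]
    simp

lemma spinMap_walls (hm : 1 ≤ m) (hφ : StrictMono φ) (hφ' : ∀ i j, φ j - φ i < 2 * Real.pi)
    {s s' : Fin (2 * m) → Bool} (hs : gen (cupMap m) ≤ Setoid.ker s)
    (hs' : gen (cupMap m) ≤ Setoid.ker s') (h : walls s = walls s') (v : V φ ε) :
    spinMap hφ hφ' ε v s = spinMap hφ hφ' ε v s' := by
  rcases eq_or_eq_not_of_walls hm hs hs' h with rfl | rfl
  · rfl
  · refine spinMap_eq_of_feature hφ hφ' (fun f k => ?_) v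
    -- A feature sees a configuration only through its kernel, which the global flip preserves.
    have : Setoid.ker (fun x => !(s x)) = Setoid.ker s := by
      ext x y
      simp [Setoid.ker_def]
    rw [feature, feature, this]

open scoped Classical in
/-- A spin configuration with given walls. -/
def spinOfWalls (W : Finset (Fin (m - 1))) : Fin (2 * m) → Bool :=
  if h : ∃ s : Fin (2 * m) → Bool, gen (cupMap m) ≤ Setoid.ker s ∧ walls s = W then h.choose
  else fun _ => false

lemma exists_injective_quot (hm : 1 ≤ m) (hφ : StrictMono φ)
    (hφ' : ∀ i j, φ j - φ i < 2 * Real.pi) (ε : ℤˣ) :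
    ∃ L : VTilde φ ε →ₗ[ℂ] (Finset (Fin (m - 1)) → ℂ), Function.Injective L := by
  refine ⟨(LinearMap.funLeft ℂ ℂ spinOfWalls).comp (spinQuot hφ hφ' ε), ?_⟩
  rw [← LinearMap.ker_eq_bot, LinearMap.ker_eq_bot']
  intro x hx
  obtain ⟨v, rfl⟩ := (formKernel φ ε).mkQ_surjective x
  refine spinQuot_injective hφ hφ' ?_
  rw [map_zero]
  funext s
  change spinMap hφ hφ' ε v s = 0
  by_cases hs : gen (cupMap m) ≤ Setoid.ker s
  -- These walls come from `s` itself, so `spinOfWalls` does not take its default value.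
  · have hex : ∃ s' : Fin (2 * m) → Bool, gen (cupMap m) ≤ Setoid.ker s' ∧ walls s' = walls s :=
      ⟨s, hs, rfl⟩
    have hW : spinOfWalls (walls s) = hex.choose := dif_pos hex
    have h0 : spinMap hφ hφ' ε v (spinOfWalls (walls s)) = 0 := congrFun hx (walls s)
    rw [hW] at h0
    rw [← h0]
    exact spinMap_walls hm hφ hφ' hs hex.choose_spec.1 hex.choose_spec.2.symm v
  · exact spinMap_eq_zero hφ hφ' hs v

end Dimension

/-! ### Orthonormality of the charged cups -/

/-- The pairings of the reconnected cups. -/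
lemma partitionFunction_cupDiagrams (hφ : StrictMono φ) (hφ' : ∀ i j, φ j - φ i < 2 * Real.pi)
    {D D' : DecHemisphere φ ε} {T T' : Finset (Fin (m - 1))} (hD : IsCupDiagram T D)
    (hD' : IsCupDiagram T' D') :
    ((√2 : ℝ) : ℂ) ^ T.card * ((√2 : ℝ) : ℂ) ^ T'.card *
      partitionFunction (D.reflect.carrier ∪ D'.carrier) =
      ((√2 ^ m : ℝ) : ℂ) * 2 ^ (T ∩ T').card := by
  obtain ⟨𝒞, arc, f, h⟩ := exists_stringData hφ hφ' D
  obtain ⟨𝒞', arc', f', h'⟩ := exists_stringData hφ hφ' D'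
  obtain ⟨𝒞₀, arc₀, h0, h₀⟩ := h.reflect
  have e1 := hD.gen_sup h
  have e2 := hD'.gen_sup h'
  have he := euler_formula h'.matching (h'.noncrossing hφ hφ') (isMatching_cupMap m)
    (isCups_cupMap m) h.matching (h.noncrossing hφ hφ')
  rw [sup_sup_distrib_right, e1, e2, chain_union] at he
  have c1 := numClasses_chain T
  have c2 := numClasses_chain T'
  have c3 := numClasses_chain (T ∪ T')
  have c4 := Finset.card_union_add_card_inter T T'
  -- The Euler formula with class counts `m - |T|`, `m - |T'|` and `m - |T ∪ T'|`, followed by `|T|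
  -- + |T'| - |T ∪ T'| = |T ∩ T'|`.
  have hL : T.card + T'.card + numClasses (gen f ⊔ gen f') = m + 2 * (T ∩ T').card := by omega
  rw [partitionFunction, h'.card_components h₀, h0, h.closed_eq_empty hD.no_closed_string,
    h'.closed_eq_empty hD'.no_closed_string, Finset.card_empty, zero_add, zero_add, ← pow_add,
    ← pow_add, hL, pow_add, pow_mul, ← Complex.ofReal_pow √2 2, Real.sq_sqrt zero_le_two]
  push_cast
  rfl

lemma pairing_chargedCups (hφ : StrictMono φ) (hφ' : ∀ i j, φ j - φ i < 2 * Real.pi)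
    {D : Finset (Fin (m - 1)) → DecHemisphere φ ε} (hD : ∀ T, IsCupDiagram T (D T))
    (S S' : Finset (Fin (m - 1))) :
    pairing φ ε (reflection φ ε (chargedCups D S)) (chargedCups D S') =
      ((√2 ^ m : ℝ) : ℂ) * if S = S' then 1 else 0 := by
  rw [← sum_charge_signs, chargedCups, chargedCups, map_sum (reflection φ ε), map_sum (pairing φ ε),
    LinearMap.sum_apply,
    Finset.mul_sum]
  refine Finset.sum_congr rfl fun T _ => ?_
  rw [map_sum, Finset.mul_sum]
  refine Finset.sum_congr rfl fun T' _ => ?_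
  rw [reflection_single, pairing_single_single, map_mul, map_pow, map_pow, map_neg, map_one,
    Complex.conj_ofReal]
  linear_combination ((-1 : ℂ) ^ (S \ T).card * (-1) ^ (S' \ T').card) *
    partitionFunction_cupDiagrams hφ hφ' (hD T) (hD T')

lemma inner_basis (hφ : StrictMono φ) (hφ' : ∀ i j, φ j - φ i < 2 * Real.pi)
    {D : Finset (Fin (m - 1)) → DecHemisphere φ ε} (hD : ∀ T, IsCupDiagram T (D T))
    (S S' : Finset (Fin (m - 1))) :
    (innerCore hφ hφ' ε).inner
      ((formKernel φ ε).mkQ ((((√(√2 ^ m))⁻¹ : ℝ) : ℂ) • chargedCups D S))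
      ((formKernel φ ε).mkQ ((((√(√2 ^ m))⁻¹ : ℝ) : ℂ) • chargedCups D S')) =
      if S = S' then 1 else 0 := by
  rw [innerCore_mkQ, (reflection φ ε).map_smulₛₗ, (pairing φ ε).map_smul, LinearMap.smul_apply, map_smul,
    pairing_chargedCups hφ hφ' hD, Complex.conj_ofReal, smul_eq_mul, smul_eq_mul, ← mul_assoc,
    ← mul_assoc, ← Complex.ofReal_mul, ← Complex.ofReal_mul]
  have h0 : (0 : ℝ) < √2 ^ m := pow_pos (Real.sqrt_pos.2 two_pos) m
  -- The normalization `2 ^ (-m/4)` occurs twice and cancels the factor `√2 ^ m` of the form.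
  have h1 : (√(√2 ^ m))⁻¹ * (√(√2 ^ m))⁻¹ * √2 ^ m = 1 := by
    rw [← mul_inv, Real.mul_self_sqrt h0.le, inv_mul_cancel₀ h0.ne']
  rw [h1, Complex.ofReal_one, one_mul]

/-- An orthonormal family for a core is linearly independent. -/
lemma linearIndependent_of_core {ι E : Type*} [Fintype ι] [DecidableEq ι] [AddCommGroup E]
    [Module ℂ E] (c : InnerProductSpace.Core ℂ E) {v : ι → E}
    (h : ∀ i j, c.inner (v i) (v j) = if i = j then 1 else 0) : LinearIndependent ℂ v := by
  let := c.toNormedAddCommGroup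
  let := InnerProductSpace.ofCore c.toCore
  exact (orthonormal_iff_ite.2 h).linearIndependent

end Quon

end

theorem mainTheorem12 (m : ℕ) (hm : 1 ≤ m) (φ : Fin (2 * m) → ℝ) (hφ : StrictMono φ)
    (hφ' : ∀ i j, φ j - φ i < 2 * Real.pi) (ε : ℤˣ) :
    Module.finrank ℂ (Quon.VTilde φ ε) = 2 ^ (m - 1) ∧
    (∀ T : Finset (Fin (m - 1)), ∃ D : Quon.DecHemisphere φ ε, Quon.IsCupDiagram T D) ∧
    ∃ c : InnerProductSpace.Core ℂ (Quon.VTilde φ ε),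
      (∀ v w : Quon.V φ ε,
        c.inner ((Quon.formKernel φ ε).mkQ v) ((Quon.formKernel φ ε).mkQ w) =
          Quon.pairing φ ε (Quon.reflection φ ε v) w) ∧
      ∀ D : Finset (Fin (m - 1)) → Quon.DecHemisphere φ ε, (∀ T, Quon.IsCupDiagram T (D T)) →
        ∃ b : Module.Basis (Finset (Fin (m - 1))) ℂ (Quon.VTilde φ ε),
          (∀ S, b S = (Quon.formKernel φ ε).mkQ
            ((((√(√2 ^ m))⁻¹ : ℝ) : ℂ) • Quon.chargedCups D S)) ∧
          ∀ S S', c.inner (b S) (b S') = if S = S' then 1 else 0 := by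
  have hex := Quon.exists_isCupDiagram hφ hφ' ε
  obtain ⟨L, hL⟩ := Quon.exists_injective_quot hm hφ hφ' ε
  have hfin : FiniteDimensional ℂ (Quon.VTilde φ ε) := FiniteDimensional.of_injective L hL
  have hcard : Fintype.card (Finset (Fin (m - 1))) = 2 ^ (m - 1) := by simp
  have hle := LinearMap.finrank_le_finrank_of_injective hL
  rw [Module.finrank_fintype_fun_eq_card] at hle
  have hrank : Fintype.card (Finset (Fin (m - 1))) = Module.finrank ℂ (Quon.VTilde φ ε) := by
    -- The lower bound needs an actual family of diagrams, whose charged cups are orthonormal and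
    -- hence independent.
    choose D hD using hex
    exact le_antisymm (Quon.linearIndependent_of_core (Quon.innerCore hφ hφ' ε)
      (Quon.inner_basis hφ hφ' hD)).fintype_card_le_finrank hle
  refine ⟨hrank.symm.trans hcard, hex, Quon.innerCore hφ hφ' ε, Quon.innerCore_mkQ hφ hφ',
    fun D hD => ?_⟩
  have hinner := Quon.inner_basis hφ hφ' hD
  have hli := Quon.linearIndependent_of_core _ hinner
  refine ⟨basisOfLinearIndependentOfCardEqFinrank hli hrank, fun S => ?_, fun S S' => ?_⟩
  · rw [coe_basisOfLinearIndependentOfCardEqFinrank]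
  · rw [coe_basisOfLinearIndependentOfCardEqFinrank]
    exact hinner S S'
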